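/- Let $k$ be a field of characteristic $\neq 2$; all algebras, coalgebras and tensor products are over $k$, and we use Sweedler's notation $\Delta(c)=c_{(1)}\otimes c_{(2)}$. Let $H_4$ be Sweedler's Hopf algebra, with basis $1,g,x,gx$, relations $g^2=1$, $x^2=0$, $xg=-gx$, and comultiplication $\Delta(g)=g\otimes g$, $\Delta(x)=x\otimes 1+g\otimes x$. **Crossed products.** For Hopf algebras $A,H$, a *crossed system* $(\triangleright,f)$ consists of linear maps $\triangleright:H\otimes A\to A$ and $f:H\otimes H\to A$ such that $\triangleright$ is a weak action, i.e. $h\triangleright 1=\varepsilon(h)1$, $1\triangleright a=a$, $h\triangleright(ab)=(h_{(1)}\triangleright a)(h_{(2)}\triangleright b)$, and such that the vector space $A\otimes H$ (with $a\otimes h$ written $a\# h$) with multiplication $$(a\# h)(c\# g)=a\,(h_{(1)}\triangleright c)\,f(h_{(2)},g_{(1)})\,\#\,h_{(3)}g_{(2)},$$ unit $1\#1$ and the tensor product coalgebra structure is a Hopf algebra; this Hopf algebra is the crossed product $A\#_f^{\triangleright}H$. Let $\mathrm{CRP}(H,A)$ be the set of Hopf algebra isomorphism types of all crossed products $A\#_f^{\triangleright}H$.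 Two crossed systems are *cohomologous*, $(\triangleright,f)\approx(\triangleright',f')$, if there is a coalgebra map $r:H\to A$ with $r(1)=1$ and $r(h_{(1)})\otimes h_{(2)}=r(h_{(2)})\otimes h_{(1)}$ such that $$h\triangleright' a=r(h_{(1)})(h_{(2)}\triangleright a)S(r(h_{(3)})),\qquad f'(h,g)=r(h_{(1)})(h_{(2)}\triangleright r(g_{(1)}))f(h_{(3)},g_{(2)})S(r(h_{(4)}g_{(3)}))$$ for all $a\in A$, $g,h\in H$. Let $\mathcal H^2(H,A)$ be the set of crossed systems modulo $\approx$. **Central primitive elements.** Let $\mathcal{ZP}(A)$ be the set of central elements $a\in A$ with $\Delta(a)=a\otimes1+1\otimes a$. For $a\in\mathcal{ZP}(A)$ let $h\triangleright b=\varepsilon(h)b$ be the trivial action of $H_4$ on $A$ and let $f_a:H_4\otimes H_4\to A$ be the linear map with $f_a(s,t)=1$ for $s,t\in\{1,g\}$, $f_a(s,t)=0$ if exactly one of $s,t$ lies in $\{1,g\}$ and the other in $\{x,gx\}$, $f_a(x,x)=f_a(gx,x)=a$ and $f_a(x,gx)=f_a(gx,gx)=-a$. **Theorem.** Let $A$ be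 a Hopf algebra over $k$ such that the only Hopf algebra map $A\to H_4$ is the trivial one $z\mapsto\varepsilon(z)1$. For each $a\in\mathcal{ZP}(A)$ the pair (trivial action, $f_a$) is a crossed system; let $A_{(a)}$ be its crossed product. (1) Define $a\equiv b$ on $\mathcal{ZP}(A)$ iff there is $(u,\beta)\in\mathrm{Aut}_{\mathrm{Hopf}}(A)\times k^*$ with $u(a)=\beta^2b$. This is an equivalence relation, and there is a bijection $\mathcal{ZP}(A)/{\equiv}\;\cong\;\mathrm{CRP}(H_4,A)$, which sends the class of $a$ to the isomorphism type of $A_{(a)}$. (2) The relation $\approx$ is an equivalence relation on the set of crossed systems for $(A,H_4)$, and there is a bijection $\mathcal{ZP}(A)\cong\mathcal H^2(H_4,A)$, which sends $a$ to the class of (trivial action, $f_a$). -/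

import Mathlib

open scoped TensorProduct
open Coalgebra TensorProduct WithConv

noncomputable section

section Sweedler

variable (k : Type*) [Field k]

/-- Sweedler's 4-dimensional algebra `⟨g, x | g² = 1, x² = 0, xg = -gx⟩`, realised as the generalised
quaternion algebra with `i² = 1`, `j² = 0`, `ij = k`, `ji = -k`. The basis `1, g, x, gx` is
`1, i, j, k`, so an element is `⟨h₀, h₁, h₂, h₃⟩ = h₀ + h₁ g + h₂ x + h₃ gx`. -/
abbrev SweedlerH4 : Type _ := QuaternionAlgebra k 1 0 0

namespace SweedlerH4

/-- The generator `g`. -/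
def g : SweedlerH4 k := ⟨0, 1, 0, 0⟩

/-- The generator `x`. -/
def x : SweedlerH4 k := ⟨0, 0, 1, 0⟩

theorem g_mul_g : g k * g k = 1 := by ext <;> simp [g]

theorem x_mul_x : x k * x k = 0 := by ext <;> simp [x]

theorem x_mul_g : x k * g k = -(g k * x k) := by ext <;> simp [x, g]

/-- The comultiplication of `H₄`: the algebra map with `g ↦ g ⊗ g` and `x ↦ x ⊗ 1 + g ⊗ x`. -/
def comulHom : SweedlerH4 k →ₐ[k] SweedlerH4 k ⊗[k] SweedlerH4 k :=
  QuaternionAlgebra.lift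
    { i := g k ⊗ₜ g k
      j := x k ⊗ₜ 1 + g k ⊗ₜ x k
      k := (g k ⊗ₜ g k) * (x k ⊗ₜ 1 + g k ⊗ₜ x k)
      i_mul_i := by
        simp [g_mul_g, Algebra.TensorProduct.one_def]
      j_mul_j := by
        simp [mul_add, add_mul, g_mul_g, x_mul_x, x_mul_g, TensorProduct.neg_tmul]
      i_mul_j := rfl
      j_mul_i := by
        simp [mul_add, add_mul, g_mul_g, x_mul_g, TensorProduct.neg_tmul,
          TensorProduct.tmul_neg]
        abel }

/-- The counit of `H₄`: the algebra map with `g ↦ 1` and `x ↦ 0`. -/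
def counitHom : SweedlerH4 k →ₐ[k] k :=
  QuaternionAlgebra.lift
    { i := 1
      j := 0
      k := 0
      i_mul_i := by simp
      j_mul_j := by simp
      i_mul_j := by simp
      j_mul_i := by simp }

theorem comulHom_g : comulHom k (g k) = g k ⊗ₜ g k := by
  simp [comulHom, g, QuaternionAlgebra.Basis.lift]

theorem comulHom_x : comulHom k (x k) = x k ⊗ₜ 1 + g k ⊗ₜ x k := by
  simp [comulHom, x, QuaternionAlgebra.Basis.lift]

theorem counitHom_apply (h : SweedlerH4 k) : counitHom k h = h.re + h.imI := by
  simp [counitHom, QuaternionAlgebra.Basis.lift]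

theorem counitHom_g : counitHom k (g k) = 1 := by simp [counitHom_apply, g]

theorem counitHom_x : counitHom k (x k) = 0 := by simp [counitHom_apply, x]

/-- Algebra maps out of `H₄` agree once they agree on `g` and `x`. -/
theorem algHom_ext {B : Type*} [Ring B] [Algebra k B] {p q : SweedlerH4 k →ₐ[k] B}
    (hg : p (g k) = q (g k)) (hx : p (x k) = q (x k)) : p = q :=
  QuaternionAlgebra.hom_ext hg hx

instance : Bialgebra k (SweedlerH4 k) :=
  Bialgebra.ofAlgHom (comulHom k) (counitHom k)
    (by
      apply algHom_ext
      · simp [comulHom_g]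
      · simp [comulHom_g, comulHom_x, TensorProduct.add_tmul, TensorProduct.tmul_add,
          Algebra.TensorProduct.one_def, add_assoc])
    (by
      apply algHom_ext
      · simp [comulHom_g, counitHom_g]
      · simp [comulHom_x, counitHom_g, counitHom_x])
    (by
      apply algHom_ext
      · simp [comulHom_g, counitHom_g]
      · simp [comulHom_x, counitHom_x])

theorem comul_apply (h : SweedlerH4 k) : comul (R := k) h = comulHom k h := rfl

theorem counit_apply (h : SweedlerH4 k) : counit (R := k) h = h.re + h.imI :=
  counitHom_apply k h

/-- The antipode of `H₄`: `1 ↦ 1`, `g ↦ g`, `x ↦ -gx`, `gx ↦ x`. -/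
def antipodeMap : SweedlerH4 k →ₗ[k] SweedlerH4 k where
  toFun h := ⟨h.re, h.imI, h.imK, -h.imJ⟩
  map_add' a b := by ext <;> simp [add_comm]
  map_smul' c a := by ext <;> simp

theorem eq_basis (h : SweedlerH4 k) :
    h = h.re • 1 + h.imI • g k + h.imJ • x k + h.imK • (g k * x k) := by
  ext <;> simp [g, x]

theorem linearMap_ext {B : Type*} [AddCommGroup B] [Module k B] {p q : SweedlerH4 k →ₗ[k] B}
    (h1 : p 1 = q 1) (hg : p (g k) = q (g k)) (hx : p (x k) = q (x k))
    (hgx : p (g k * x k) = q (g k * x k)) : p = q := by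
  ext h
  rw [eq_basis k h]
  simp only [map_add, map_smul, h1, hg, hx, hgx]

instance : HopfAlgebra k (SweedlerH4 k) where
  antipode := antipodeMap k
  mul_antipode_rTensor_comul := by
    apply linearMap_ext
    · simp [Algebra.TensorProduct.one_def]
      ext <;> simp [antipodeMap]
    · simp [comul_apply, comulHom_g, counit_apply]
      ext <;> simp [antipodeMap, g]
    · simp [comul_apply, comulHom_x, counit_apply]
      ext <;> simp [antipodeMap, g, x]
    · simp [comul_apply, comulHom_g, comulHom_x, counit_apply, mul_add]
      ext <;> simp [antipodeMap, g, x]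
  mul_antipode_lTensor_comul := by
    apply linearMap_ext
    · simp [Algebra.TensorProduct.one_def]
      ext <;> simp [antipodeMap]
    · simp [comul_apply, comulHom_g, counit_apply]
      ext <;> simp [antipodeMap, g]
    · simp [comul_apply, comulHom_x, counit_apply]
      ext <;> simp [antipodeMap, g, x]
    · simp [comul_apply, comulHom_g, comulHom_x, counit_apply, mul_add]
      ext <;> simp [antipodeMap, g, x]

end SweedlerH4

end Sweedler

section CrossedProducts

variable {k A H : Type*} [Field k] [Ring A] [HopfAlgebra k A] [Ring H] [HopfAlgebra k H]

/-- A weak action `▷ : H ⊗ A → A`: `h ▷ 1 = ε(h) 1`, `1 ▷ a = a` and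
`h ▷ (ab) = ∑ (h₁ ▷ a) (h₂ ▷ b)`. -/
structure IsWeakAction (act : H ⊗[k] A →ₗ[k] A) : Prop where
  act_one : ∀ h : H, act (h ⊗ₜ 1) = counit (R := k) h • (1 : A)
  one_act : ∀ a : A, act (1 ⊗ₜ a) = a
  act_mul : ∀ (h : H) (a b : A), act (h ⊗ₜ (a * b)) =
    LinearMap.mul' k A (TensorProduct.map (act ∘ₗ (TensorProduct.mk k H A).flip a)
      (act ∘ₗ (TensorProduct.mk k H A).flip b) (comul h))

/-- The linear map `A ⊗ (A ⊗ H) → A ⊗ H`, `a ⊗ (c ⊗ h) ↦ ac ⊗ h`. -/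
def leftMulMap (k A H : Type*) [Field k] [Ring A] [HopfAlgebra k A] [Ring H] [HopfAlgebra k H] :
    A ⊗[k] (A ⊗[k] H) →ₗ[k] A ⊗[k] H :=
  (LinearMap.mul' k A).rTensor H ∘ₗ (TensorProduct.assoc k A A H).symm.toLinearMap

/-- The linear map `H ⊗ H → A ⊗ H`, `h ⊗ g ↦ ∑ f(h₁, g₁) ⊗ h₂ g₂`. -/
def cocycleMulMap (f : H ⊗[k] H →ₗ[k] A) : H ⊗[k] H →ₗ[k] A ⊗[k] H :=
  TensorProduct.map f (LinearMap.mul' k H) ∘ₗ comul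

/-- The linear map `H ⊗ (A ⊗ H) → A ⊗ H`,
`h ⊗ (c ⊗ g) ↦ ∑ (h₁ ▷ c) f(h₂, g₁) ⊗ h₃ g₂`. -/
def crossedActMap (act : H ⊗[k] A →ₗ[k] A) (f : H ⊗[k] H →ₗ[k] A) :
    H ⊗[k] (A ⊗[k] H) →ₗ[k] A ⊗[k] H :=
  leftMulMap k A H ∘ₗ TensorProduct.map act (cocycleMulMap f) ∘ₗ
    (TensorProduct.tensorTensorTensorComm k H H A H).toLinearMap ∘ₗ comul.rTensor (A ⊗[k] H)

/-- The multiplication of the crossed product on `A ⊗ H`: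
`(a # h)(c # g) = ∑ a (h₁ ▷ c) f(h₂, g₁) # h₃ g₂`. -/
def crossedMul (act : H ⊗[k] A →ₗ[k] A) (f : H ⊗[k] H →ₗ[k] A) :
    A ⊗[k] H →ₗ[k] A ⊗[k] H →ₗ[k] A ⊗[k] H :=
  TensorProduct.curry (leftMulMap k A H ∘ₗ (crossedActMap act f).lTensor A ∘ₗ
    (TensorProduct.assoc k A H (A ⊗[k] H)).toLinearMap)

/-- The multiplication in Sweedler notation, for arbitrary representations of the
iterated comultiplications of `h` and `g`. -/
theorem crossedMul_tmul (act : H ⊗[k] A →ₗ[k] A) (f : H ⊗[k] H →ₗ[k] A) (a c : A) (h g : H)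
    {ι ι' ι'' : Type*} (rh : Coalgebra.Repr k h ι) (rh' : ∀ i, Coalgebra.Repr k (rh.right i) ι')
    (rg : Coalgebra.Repr k g ι'') :
    crossedMul act f (a ⊗ₜ h) (c ⊗ₜ g) =
      ∑ i ∈ rh.index, ∑ j ∈ (rh' i).index, ∑ l ∈ rg.index,
        (a * (act (rh.left i ⊗ₜ c) * f ((rh' i).left j ⊗ₜ rg.left l))) ⊗ₜ
          ((rh' i).right j * rg.right l) := by
  have key : ∀ i, cocycleMulMap f (rh.right i ⊗ₜ g) = ∑ j ∈ (rh' i).index, ∑ l ∈ rg.index,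
      f ((rh' i).left j ⊗ₜ rg.left l) ⊗ₜ[k] ((rh' i).right j * rg.right l) := by
    intro i
    simp only [cocycleMulMap, LinearMap.comp_apply, TensorProduct.comul_tmul, ← (rh' i).eq,
      ← rg.eq, TensorProduct.sum_tmul, TensorProduct.tmul_sum, map_sum]
    rw [Finset.sum_comm]
    simp
  simp only [crossedMul, crossedActMap, TensorProduct.curry_apply, LinearMap.comp_apply,
    LinearEquiv.coe_coe, TensorProduct.assoc_tmul, LinearMap.lTensor_tmul,
    LinearMap.rTensor_tmul, ← rh.eq, TensorProduct.sum_tmul, map_sum,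
    TensorProduct.tensorTensorTensorComm_tmul, TensorProduct.map_tmul, key,
    TensorProduct.tmul_sum, leftMulMap, TensorProduct.assoc_symm_tmul, LinearMap.mul'_apply]

variable (k A H) in
/-- A crossed system of Hopf algebras `(A, H, ▷, f)`: a weak action `▷` of `H` on `A` and a linear
map `f : H ⊗ H → A` such that `A ⊗ H`, with the crossed product multiplication, the unit `1 # 1`
and the tensor product coalgebra structure, is a Hopf algebra. (That counit and comultiplication
preserve the unit holds automatically.) -/
@[ext]
structure CrossedSystem where
  act : H ⊗[k] A →ₗ[k] A
  cocycle : H ⊗[k] H →ₗ[k] A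
  weak : IsWeakAction act
  one_mul : ∀ z : A ⊗[k] H, crossedMul act cocycle (1 ⊗ₜ 1) z = z
  mul_one : ∀ z : A ⊗[k] H, crossedMul act cocycle z (1 ⊗ₜ 1) = z
  mul_assoc : ∀ y z w : A ⊗[k] H, crossedMul act cocycle (crossedMul act cocycle y z) w =
    crossedMul act cocycle y (crossedMul act cocycle z w)
  counit_mul : ∀ y z : A ⊗[k] H, counit (R := k) (crossedMul act cocycle y z) =
    counit (R := k) y * counit (R := k) z
  comul_mul : ∀ y z : A ⊗[k] H, comul (R := k) (crossedMul act cocycle y z) =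
    TensorProduct.map₂ (crossedMul act cocycle) (crossedMul act cocycle)
      (comul (R := k) y) (comul (R := k) z)
  exists_antipode : ∃ S : A ⊗[k] H →ₗ[k] A ⊗[k] H, ∀ z : A ⊗[k] H,
    TensorProduct.lift (crossedMul act cocycle) (S.rTensor (A ⊗[k] H) (comul (R := k) z)) =
        counit (R := k) z • (1 ⊗ₜ 1) ∧
      TensorProduct.lift (crossedMul act cocycle) (S.lTensor (A ⊗[k] H) (comul (R := k) z)) =
        counit (R := k) z • (1 ⊗ₜ 1)

namespace CrossedSystem

/-- The underlying vector space `A ⊗ H` of the crossed product `A # H` of a crossed system. -/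
def Product (_ : CrossedSystem k A H) : Type _ := A ⊗[k] H

variable (S : CrossedSystem k A H)

instance : AddCommGroup S.Product := inferInstanceAs (AddCommGroup (A ⊗[k] H))

instance : Module k S.Product := inferInstanceAs (Module k (A ⊗[k] H))

instance : Ring S.Product where
  __ := (inferInstance : AddCommGroup S.Product)
  mul y z := crossedMul S.act S.cocycle y z
  one := ((1 : A) ⊗ₜ[k] (1 : H) : A ⊗[k] H)
  left_distrib y z w := (crossedMul S.act S.cocycle y).map_add z w
  right_distrib y z w := (crossedMul S.act S.cocycle).map_add₂ y z w
  zero_mul z := (crossedMul S.act S.cocycle).map_zero₂ z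
  mul_zero z := (crossedMul S.act S.cocycle z).map_zero
  mul_assoc := S.mul_assoc
  one_mul := S.one_mul
  mul_one := S.mul_one

instance : Algebra k S.Product :=
  Algebra.ofModule
    (fun r y z => (crossedMul S.act S.cocycle).map_smul₂ r y z)
    (fun r y z => (crossedMul S.act S.cocycle y).map_smul r z)

instance : Coalgebra k S.Product := inferInstanceAs (Coalgebra k (A ⊗[k] H))

instance : Bialgebra k S.Product :=
  Bialgebra.mk' k S.Product
    (by
      change counit (R := k) ((1 : A) ⊗ₜ[k] (1 : H)) = 1
      simp)
    (fun {y z} => S.counit_mul y z)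
    (by
      change comul (R := k) ((1 : A) ⊗ₜ[k] (1 : H)) =
        ((1 : A) ⊗ₜ[k] (1 : H)) ⊗ₜ[k] ((1 : A) ⊗ₜ[k] (1 : H))
      simp [Algebra.TensorProduct.one_def])
    (fun {y z} => by
      refine (S.comul_mul y z).trans ?_
      change _ = (show S.Product ⊗[k] S.Product from comul (R := k) (A := A ⊗[k] H) y) *
        (show S.Product ⊗[k] S.Product from comul (R := k) (A := A ⊗[k] H) z)
      generalize comul (R := k) (A := A ⊗[k] H) y = p
      generalize comul (R := k) (A := A ⊗[k] H) z = q
      have e : (TensorProduct.map₂ (crossedMul S.act S.cocycle) (crossedMul S.act S.cocycle) :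
          S.Product ⊗[k] S.Product →ₗ[k] S.Product ⊗[k] S.Product →ₗ[k]
            S.Product ⊗[k] S.Product) = LinearMap.mul k (S.Product ⊗[k] S.Product) := by
        refine TensorProduct.ext' fun a b => ?_
        refine TensorProduct.ext' fun c d => ?_
        exact (Algebra.TensorProduct.tmul_mul_tmul (R := k) (A := S.Product) (B := S.Product)
          a c b d).symm
      exact LinearMap.congr_fun₂ e p q)

/-- The crossed product `A # H` of Hopf algebras. -/
instance : HopfAlgebra k S.Product where
  antipode := S.exists_antipode.choose
  mul_antipode_rTensor_comul := by
    refine LinearMap.ext fun z => ?_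
    refine (S.exists_antipode.choose_spec z).1.trans ?_
    exact (Algebra.algebraMap_eq_smul_one (R := k) (A := S.Product) _).symm
  mul_antipode_lTensor_comul := by
    refine LinearMap.ext fun z => ?_
    refine (S.exists_antipode.choose_spec z).2.trans ?_
    exact (Algebra.algebraMap_eq_smul_one (R := k) (A := S.Product) _).symm

/-- Two crossed systems are isomorphic if their crossed products are isomorphic as Hopf algebras. -/
def isoSetoid (k H A : Type*) [Field k] [Ring A] [HopfAlgebra k A] [Ring H] [HopfAlgebra k H] :
    Setoid (CrossedSystem k A H) where
  r S T := Nonempty (S.Product ≃ₐc[k] T.Product)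
  iseqv :=
    { refl := fun S => ⟨BialgEquiv.refl k S.Product⟩
      symm := fun ⟨e⟩ => ⟨e.symm⟩
      trans := fun ⟨e⟩ ⟨e'⟩ => ⟨e.trans e'⟩ }

end CrossedSystem

/-- `CRP(H, A)`: the set of Hopf algebra isomorphism types of all crossed products `A # H`. -/
def Crp (k H A : Type*) [Field k] [Ring A] [HopfAlgebra k A] [Ring H] [HopfAlgebra k H] : Type _ :=
  Quotient (CrossedSystem.isoSetoid k H A)

/-- The isomorphism type of the crossed product of a crossed system. -/
def Crp.mk (S : CrossedSystem k A H) : Crp k H A :=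
  Quotient.mk (CrossedSystem.isoSetoid k H A) S

/-- A unitary cocentral map `r : H → A`: a coalgebra map with `r(1) = 1` and
`∑ r(h₁) ⊗ h₂ = ∑ r(h₂) ⊗ h₁`. -/
structure IsUnitaryCocentral (r : H →ₗc[k] A) : Prop where
  map_one : r 1 = 1
  cocentral : ∀ h : H, (r : H →ₗ[k] A).rTensor H (comul h) =
    (r : H →ₗ[k] A).rTensor H (TensorProduct.comm k H H (comul h))

/-- Crossed systems `(▷, f)` and `(▷', f')` are cohomologous if there is a unitary cocentral map
`r : H → A` with
`h ▷' a = ∑ r(h₁) (h₂ ▷ a) S(r(h₃))` and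
`f'(h, g) = ∑ r(h₁) (h₂ ▷ r(g₁)) f(h₃, g₂) S(r(h₄ g₃))`.
The products below are convolution products, on `Hom(H, A)` and on `Hom(H ⊗ H, A)`. -/
def Cohomologous (S T : CrossedSystem k A H) : Prop :=
  ∃ r : H →ₗc[k] A, IsUnitaryCocentral r ∧
    (∀ a : A, toConv (T.act ∘ₗ (TensorProduct.mk k H A).flip a) =
      toConv (r : H →ₗ[k] A) * toConv (S.act ∘ₗ (TensorProduct.mk k H A).flip a) *
        toConv (HopfAlgebra.antipode k ∘ₗ (r : H →ₗ[k] A))) ∧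
    toConv T.cocycle =
      toConv ((r : H →ₗ[k] A) ∘ₗ (TensorProduct.rid k H).toLinearMap ∘ₗ
          (counit (R := k) (A := H)).lTensor H) *
        toConv (S.act ∘ₗ (r : H →ₗ[k] A).lTensor H) * toConv S.cocycle *
        toConv (HopfAlgebra.antipode k ∘ₗ (r : H →ₗ[k] A) ∘ₗ LinearMap.mul' k H)

/-- `ℋ²(H, A)`: crossed systems of Hopf algebras modulo the relation of being cohomologous. -/
def HopfH2 (k H A : Type*) [Field k] [Ring A] [HopfAlgebra k A] [Ring H] [HopfAlgebra k H] :
    Type _ :=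
  Quot (Cohomologous (k := k) (A := A) (H := H))

/-- The cohomology class of a crossed system. -/
def HopfH2.mk (S : CrossedSystem k A H) : HopfH2 k H A := Quot.mk _ S

variable (k A) in
/-- `𝒵𝒫(A)`: the set of central primitive elements of `A`. -/
def CentralPrimitive : Type _ :=
  {a : A // comul (R := k) a = a ⊗ₜ[k] 1 + 1 ⊗ₜ[k] a ∧ ∀ b : A, a * b = b * a}

variable (k A) in
/-- The equivalence relation on central primitive elements: `a ≡ b` iff `u(a) = β² b` for some Hopf
algebra automorphism `u` of `A` and some nonzero scalar `β`. -/
def CentralPrimitive.setoid : Setoid (CentralPrimitive k A) where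
  r a b := ∃ (u : A ≃ₐc[k] A) (β : kˣ), u a.1 = ((β : k) ^ 2) • b.1
  iseqv :=
    { refl := fun a => ⟨BialgEquiv.refl k A, 1, by simp⟩
      symm := by
        rintro a b ⟨u, β, h⟩
        refine ⟨u.symm, β⁻¹, ?_⟩
        have h' : a.1 = ((β : k) ^ 2) • u.symm b.1 := by
          rw [← map_smul, ← h, BialgEquiv.symm_apply_apply]
        rw [h', smul_smul, ← mul_pow, Units.inv_mul, one_pow, one_smul]
      trans := by
        rintro a b c ⟨u, β, h⟩ ⟨v, γ, h'⟩
        refine ⟨u.trans v, β * γ, ?_⟩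
        change v (u a.1) = _
        rw [h, map_smul, h', smul_smul, ← mul_pow, Units.val_mul] }

/-- The trivial action `h ▷ a = ε(h) a`. -/
def trivialAction (k H A : Type*) [Field k] [Ring A] [HopfAlgebra k A] [Ring H] [HopfAlgebra k H] :
    H ⊗[k] A →ₗ[k] A :=
  (TensorProduct.lid k A).toLinearMap ∘ₗ (counit (R := k) (A := H)).rTensor A

/-- The cocycle `f_a : H₄ ⊗ H₄ → A`: on the basis `1, g, x, gx`, it is `1` on pairs from `{1, g}`,
`0` on mixed pairs, and `f_a(x, x) = f_a(gx, x) = a`, `f_a(x, gx) = f_a(gx, gx) = -a`. -/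
def sweedlerCocycle (a : A) : SweedlerH4 k ⊗[k] SweedlerH4 k →ₗ[k] A :=
  TensorProduct.lift (LinearMap.mk₂ k
    (fun h l : SweedlerH4 k => ((h.re + h.imI) * (l.re + l.imI)) • (1 : A) +
      ((h.imJ + h.imK) * (l.imJ - l.imK)) • a)
    (fun h h' l => by simp; module)
    (fun c h l => by simp; module)
    (fun h l l' => by simp; module)
    (fun c h l => by simp; module))

end CrossedProducts

end

/-!
Write `G = 1 # g` and `X = 1 # x` in a crossed product `A # H₄`.

*Crossed systems.* Write `π_A`, `π_H` for the projections of `A # H` onto its factors. For every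
element `z` of a crossed product, `z = ∑ π_A(z₁) # π_H(z₂)` and also `z` is the flip of
`∑ π_H(z₁) ⊗ π_A(z₂)` (`CrossedSystem.map_projLeft_projRight_comul`,
`CrossedSystem.map_projRight_projLeft_comul`). Since the comultiplication is multiplicative,
applying this to `XG`, `GX` and `Xc` for `c` in `A` and comparing coefficients in the basis
`1, g, x, gx` gives `G² = 1`, `GX = 1 # gx = -XG`, and that `G` and `X` commute with `A`.
Applied to `X²` it gives `X² = a # 1` with `a` primitive, and `a` is central because `X` commutes
with `A`. So the action is trivial and the cocycle is `f_a`
(`CrossedSystem.act_eq_trivialAction`, `CrossedSystem.cocycle_eq_sweedlerCocycle`). Conversely the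
trivial action and `f_a` define the multiplication `(c # s)(d # t) = cd # st + cda # μ(s, t)` for a
bilinear map `μ` on `H₄` that does not depend on `a`; it is a Hopf algebra since `a` is central and
primitive and by identities for `μ` that are checked in coordinates (`sweedlerSystem`). Hence
crossed systems for `(A, H₄)` correspond bijectively to central primitive elements.

*Cohomology.* A unitary cocentral map `H₄ → A` is trivial, by the same comparison of coefficients
(`IsUnitaryCocentral.apply_eq`), so cohomologous crossed systems are equal
(`cohomologous_iff_eq`).

*Isomorphism types.* Let `e` be an isomorphism from the crossed product of `a` to that of `b`. The
composite `A → A # H₄ → A # H₄ → H₄` is trivial by hypothesis, so `e` maps `A` into the coinvariants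
of `π_H`, which are `A`; this gives an automorphism `u` of `A` (`CrossedSystem.restrictEquiv`). The
element `π_H(e(G))` is grouplike, and it is `g` since otherwise `π_H ∘ e` would not be surjective in
characteristic `≠ 2`; then `π_H(e(X))` is a nonzero multiple `βx` and cocentrality gives `e(X) = βX`
(`CrossedSystem.exists_map_sec_x`). Squaring yields `u(a) = β² b`. Conversely such `u` and `β`
define the isomorphism `c # h ↦ u(c) # v(h)` with `v(g) = g`, `v(x) = βx`
(`nonempty_bialgEquiv_sweedlerSystem`).
-/

noncomputable section

/-! ### Identities in Sweedler's Hopf algebra -/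

namespace SweedlerH4

variable (k : Type*) [Field k]

theorem comul_g : comul (R := k) (g k) = g k ⊗ₜ g k := comulHom_g k

theorem comul_x : comul (R := k) (x k) = x k ⊗ₜ 1 + g k ⊗ₜ x k := comulHom_x k

theorem comul_one : comul (R := k) (1 : SweedlerH4 k) = 1 ⊗ₜ 1 := by
  rw [Bialgebra.comul_one, Algebra.TensorProduct.one_def]

theorem comul_gx : comul (R := k) (g k * x k) = (g k * x k) ⊗ₜ g k + 1 ⊗ₜ (g k * x k) := by
  rw [Bialgebra.comul_mul, comul_g, comul_x]
  simp [mul_add, g_mul_g]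

theorem counit_g : counit (R := k) (g k) = 1 := counitHom_g k

theorem counit_x : counit (R := k) (x k) = 0 := counitHom_x k

theorem g_mul_gx : g k * (g k * x k) = x k := by rw [← mul_assoc, g_mul_g, one_mul]

theorem gx_mul_g : g k * x k * g k = -x k := by
  rw [mul_assoc, x_mul_g, mul_neg, g_mul_gx]

theorem gx_mul_x : g k * x k * x k = 0 := by rw [mul_assoc, x_mul_x, mul_zero]

theorem x_mul_gx : x k * (g k * x k) = 0 := by
  rw [← mul_assoc, x_mul_g, neg_mul, gx_mul_x, neg_zero]

theorem gx_mul_gx : g k * x k * (g k * x k) = 0 := by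
  rw [mul_assoc, x_mul_gx, mul_zero]

/-- The bilinear map `μ` on `H₄` recording the deformation of the relation `x² = 0` into `x² = a`:
in the algebra generated by `g`, `x` and a central `a` with `g² = 1`, `x² = a`, `xg = -gx`, the
product of the basis elements named `s` and `t` is `st + a μ(s, t)`. -/
def deform : SweedlerH4 k →ₗ[k] SweedlerH4 k →ₗ[k] SweedlerH4 k :=
  LinearMap.mk₂ k
    (fun s t => ⟨s.imJ * t.imJ - s.imK * t.imK, s.imK * t.imJ - s.imJ * t.imK, 0, 0⟩)
    (fun s s' t => by ext <;> simp <;> ring)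
    (fun c s t => by ext <;> simp <;> ring)
    (fun s t t' => by ext <;> simp <;> ring)
    (fun c s t => by ext <;> simp <;> ring)

theorem deform_apply (s t : SweedlerH4 k) : deform k s t =
    ⟨s.imJ * t.imJ - s.imK * t.imK, s.imK * t.imJ - s.imJ * t.imK, 0, 0⟩ := rfl

/-- `μ` is a Hochschild 2-cocycle of `H₄`: associativity to first order in `a`. -/
theorem deform_assoc (s t m : SweedlerH4 k) :
    deform k (s * t) m + deform k s t * m = deform k s (t * m) + s * deform k t m := by
  ext <;> simp [deform_apply] <;> ring

theorem deform_deform_left (s t m : SweedlerH4 k) : deform k (deform k s t) m = 0 := by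
  ext <;> simp [deform_apply]

theorem deform_deform_right (s t m : SweedlerH4 k) : deform k s (deform k t m) = 0 := by
  ext <;> simp [deform_apply]

/-- Bilinear maps on `H₄` agree once they agree on the basis `1, g, x, gx`. -/
theorem bilin_ext {B : Type*} [AddCommGroup B] [Module k B]
    {p q : SweedlerH4 k →ₗ[k] SweedlerH4 k →ₗ[k] B}
    (h : ∀ s ∈ ({1, g k, x k, g k * x k} : Set (SweedlerH4 k)),
      ∀ t ∈ ({1, g k, x k, g k * x k} : Set (SweedlerH4 k)), p s t = q s t) : p = q := by
  have key : ∀ s ∈ ({1, g k, x k, g k * x k} : Set (SweedlerH4 k)), p s = q s := fun s hs =>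
    linearMap_ext k (h s hs _ (by simp)) (h s hs _ (by simp)) (h s hs _ (by simp))
      (h s hs _ (by simp))
  exact linearMap_ext k (key _ (by simp)) (key _ (by simp)) (key _ (by simp)) (key _ (by simp))

theorem deform_one_left (t : SweedlerH4 k) : deform k 1 t = 0 := by
  ext <;> simp [deform_apply]
theorem deform_one_right (t : SweedlerH4 k) : deform k t 1 = 0 := by
  ext <;> simp [deform_apply]
theorem deform_g_left (t : SweedlerH4 k) : deform k (g k) t = 0 := by
  ext <;> simp [deform_apply, g]
theorem deform_g_right (t : SweedlerH4 k) : deform k t (g k) = 0 := by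
  ext <;> simp [deform_apply, g]
theorem deform_x_x : deform k (x k) (x k) = 1 := by
  ext <;> simp [deform_apply, x]
theorem deform_gx_x : deform k (g k * x k) (x k) = g k := by
  ext <;> simp [deform_apply, x, g]
theorem deform_x_gx : deform k (x k) (g k * x k) = -g k := by
  ext <;> simp [deform_apply, x, g]
theorem deform_gx_gx : deform k (g k * x k) (g k * x k) = -1 := by
  ext <;> simp [deform_apply, x, g]

theorem comul_deform_left (s t : SweedlerH4 k) : comul (R := k) (deform k s t) =
    map₂ (deform k) (LinearMap.mul k _) (comul (R := k) s) (comul (R := k) t) := by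
  suffices h : (deform k).compr₂ (comul (R := k)) =
      (map₂ (deform k) (LinearMap.mul k _)).compl₁₂ comul comul from LinearMap.congr_fun₂ h s t
  refine bilin_ext k ?_
  rintro s (rfl | rfl | rfl | rfl) t (rfl | rfl | rfl | rfl) <;>
    simp [comul_one, comul_g, comul_x, comul_gx, -Bialgebra.comul_mul, -Bialgebra.comul_one,
      deform_one_left, deform_one_right, deform_g_left, deform_g_right, deform_x_x, deform_gx_x,
      deform_x_gx, deform_gx_gx, g_mul_g, TensorProduct.neg_tmul]

theorem comul_deform_right (s t : SweedlerH4 k) : comul (R := k) (deform k s t) =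
    map₂ (LinearMap.mul k _) (deform k) (comul (R := k) s) (comul (R := k) t) := by
  suffices h : (deform k).compr₂ (comul (R := k)) =
      (map₂ (LinearMap.mul k _) (deform k)).compl₁₂ comul comul from LinearMap.congr_fun₂ h s t
  refine bilin_ext k ?_
  rintro s (rfl | rfl | rfl | rfl) t (rfl | rfl | rfl | rfl) <;>
    simp [comul_one, comul_g, comul_x, comul_gx, -Bialgebra.comul_mul, -Bialgebra.comul_one,
      deform_one_left, deform_one_right, deform_g_left, deform_g_right, deform_x_x, deform_gx_x,
      deform_x_gx, deform_gx_gx, g_mul_g, TensorProduct.tmul_neg]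

theorem map_deform_deform (s t : SweedlerH4 k) :
    map₂ (deform k) (deform k) (comul (R := k) s) (comul (R := k) t) = 0 := by
  suffices h : (map₂ (deform k) (deform k)).compl₁₂ (comul (R := k)) (comul (R := k)) = 0 from
    LinearMap.congr_fun₂ h s t
  refine bilin_ext k ?_
  rintro s (rfl | rfl | rfl | rfl) t (rfl | rfl | rfl | rfl) <;>
    simp [comul_one, comul_g, comul_x, comul_gx, -Bialgebra.comul_mul, -Bialgebra.comul_one,
      deform_one_left, deform_one_right, deform_g_left, deform_g_right]

/-- `∑ μ(S(h₁), h₂) = 0 = ∑ μ(h₁, S(h₂))`. -/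
theorem lift_deform_antipode (h : SweedlerH4 k) :
    TensorProduct.lift (deform k) ((HopfAlgebra.antipode k).rTensor _ (comul (R := k) h)) = 0 ∧
    TensorProduct.lift (deform k) ((HopfAlgebra.antipode k).lTensor _ (comul (R := k) h)) = 0 := by
  have hS (y : SweedlerH4 k) : HopfAlgebra.antipode k y = antipodeMap k y := rfl
  constructor
  · suffices h' : TensorProduct.lift (deform k) ∘ₗ (HopfAlgebra.antipode k).rTensor _ ∘ₗ
        comul (R := k) = 0 from LinearMap.congr_fun h' h
    apply linearMap_ext <;>
      simp [comul_one, comul_g, comul_x, comul_gx, -Bialgebra.comul_mul, -Bialgebra.comul_one,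
        deform_one_right, deform_g_right] <;>
      simp [deform_apply, hS, antipodeMap, g] <;>
      rfl
  · suffices h' : TensorProduct.lift (deform k) ∘ₗ (HopfAlgebra.antipode k).lTensor _ ∘ₗ
        comul (R := k) = 0 from LinearMap.congr_fun h' h
    apply linearMap_ext <;>
      simp [comul_one, comul_g, comul_x, comul_gx, -Bialgebra.comul_mul, -Bialgebra.comul_one,
        deform_one_left, deform_g_left] <;>
      simp [deform_apply, hS, antipodeMap, g] <;>
      rfl

end SweedlerH4

/-! ### The crossed system of a central primitive element -/

section TrivialAction

variable {k A H : Type*} [Field k] [Ring A] [HopfAlgebra k A] [Ring H] [HopfAlgebra k H]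

theorem trivialAction_tmul (h : H) (c : A) :
    trivialAction k H A (h ⊗ₜ c) = counit (R := k) h • c := by
  simp [trivialAction]

theorem trivialAction_comp_mk_flip (c : A) :
    trivialAction k H A ∘ₗ (TensorProduct.mk k H A).flip c =
      LinearMap.toSpanSingleton k A c ∘ₗ counit := by
  ext h
  simp [trivialAction_tmul]

theorem isWeakAction_trivialAction : IsWeakAction (trivialAction k H A) where
  act_one h := trivialAction_tmul h 1
  one_act c := by simp [trivialAction_tmul]
  act_mul h c d := by
    simp only [trivialAction_comp_mk_flip, trivialAction_tmul]
    rw [← (ℛ k h).eq]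
    simp only [map_sum, TensorProduct.map_tmul, LinearMap.comp_apply,
      LinearMap.toSpanSingleton_apply,
      LinearMap.mul'_apply, smul_mul_smul_comm, ← Finset.sum_smul]
    congr 1
    conv_lhs => rw [← sum_counit_smul (ℛ k h)]
    simp

theorem leftMulMap_tmul (c d : A) (h : H) :
    leftMulMap k A H (c ⊗ₜ (d ⊗ₜ h)) = (c * d) ⊗ₜ h := by
  simp [leftMulMap]

/-- Multiplication by elements of `A` on the left is the multiplication in the first factor. -/
theorem crossedMul_tmul_left (act : H ⊗[k] A →ₗ[k] A) (f : H ⊗[k] H →ₗ[k] A) (c : A) (h : H)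
    (z : A ⊗[k] H) :
    crossedMul act f (c ⊗ₜ h) z = leftMulMap k A H (c ⊗ₜ crossedActMap act f (h ⊗ₜ z)) := by
  simp [crossedMul]

theorem crossedActMap_trivialAction (f : H ⊗[k] H →ₗ[k] A) (d : A) (h l : H) :
    crossedActMap (trivialAction k H A) f (h ⊗ₜ (d ⊗ₜ l)) =
      leftMulMap k A H (d ⊗ₜ cocycleMulMap f (h ⊗ₜ l)) := by
  simp only [crossedActMap, LinearMap.comp_apply, LinearMap.rTensor_tmul, LinearEquiv.coe_coe]
  rw [← (ℛ k h).eq]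
  simp only [sum_tmul, map_sum, tensorTensorTensorComm_tmul, TensorProduct.map_tmul,
    trivialAction_tmul]
  conv_rhs => rw [← sum_counit_smul (ℛ k h)]
  simp [sum_tmul, tmul_sum, smul_tmul]

end TrivialAction

section Deformation

variable {k A H : Type*} [Field k] [Ring A] [HopfAlgebra k A] [Ring H] [HopfAlgebra k H]

variable (k A H) in
/-- The shuffle `(A ⊗ A) ⊗ (H ⊗ H) → (A ⊗ H) ⊗ (A ⊗ H)`. -/
abbrev shuffle : (A ⊗[k] A) ⊗[k] (H ⊗[k] H) →ₗ[k] (A ⊗[k] H) ⊗[k] (A ⊗[k] H) :=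
  (tensorTensorTensorComm k A A H H).toLinearMap

theorem comul_tmul_eq_shuffle (c : A) (s : H) :
    comul (R := k) (c ⊗ₜ[k] s) = shuffle k A H (comul c ⊗ₜ comul s) := rfl

theorem counit_eq_zero_of_primitive {a : A} (h : comul (R := k) a = a ⊗ₜ[k] 1 + 1 ⊗ₜ[k] a) :
    counit (R := k) a = 0 := by
  have h1 := congrArg (counit (R := k) ∘ₗ (TensorProduct.lid k A).toLinearMap ∘ₗ
    counit.rTensor A) h
  simpa using h1

/-- `IsDeformation a μ M` says that the bilinear map `M` on `A ⊗ H` is the deformation of the tensor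
product multiplication by the element `a` of `A` and the bilinear map `μ` on `H`:
`(c ⊗ s)(d ⊗ t) = cd ⊗ st + cda ⊗ μ(s, t)`. -/
def IsDeformation (a : A) (μ : H →ₗ[k] H →ₗ[k] H)
    (M : A ⊗[k] H →ₗ[k] A ⊗[k] H →ₗ[k] A ⊗[k] H) : Prop :=
  ∀ (c d : A) (s t : H), M (c ⊗ₜ s) (d ⊗ₜ t) = (c * d) ⊗ₜ (s * t) + (c * d * a) ⊗ₜ μ s t

namespace IsDeformation

variable {a : A} {μ : H →ₗ[k] H →ₗ[k] H} {M : A ⊗[k] H →ₗ[k] A ⊗[k] H →ₗ[k] A ⊗[k] H}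

theorem one_mul (hM : IsDeformation a μ M) (h : ∀ t, μ 1 t = 0) (z : A ⊗[k] H) :
    M (1 ⊗ₜ 1) z = z := by
  induction z with
  | zero => rw [LinearMap.map_zero]
  | add y z hy hz => rw [map_add, hy, hz]
  | tmul d t => rw [hM, h, tmul_zero, add_zero, _root_.one_mul, _root_.one_mul]

theorem mul_one (hM : IsDeformation a μ M) (h : ∀ t, μ t 1 = 0) (z : A ⊗[k] H) :
    M z (1 ⊗ₜ 1) = z := by
  induction z with
  | zero => rw [LinearMap.map_zero₂]
  | add y z hy hz => rw [LinearMap.map_add₂, hy, hz]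
  | tmul d t => rw [hM, h, tmul_zero, add_zero, _root_.mul_one, _root_.mul_one]

/-- The part of associativity that is linear in `a` is the hypothesis `h`, and the quadratic parts
vanish by `h₁` and `h₂`. -/
theorem mul_assoc (hM : IsDeformation a μ M) (ha : ∀ b : A, a * b = b * a)
    (h : ∀ s t m, μ (s * t) m + μ s t * m = μ s (t * m) + s * μ t m)
    (h₁ : ∀ s t m, μ (μ s t) m = 0) (h₂ : ∀ s t m, μ s (μ t m) = 0) (y z w : A ⊗[k] H) :
    M (M y z) w = M y (M z w) := by
  induction y with
  | zero => simp only [LinearMap.map_zero, LinearMap.zero_apply]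
  | add y y' hy hy' => simp only [LinearMap.map_add, LinearMap.add_apply, hy, hy']
  | tmul c s =>
  induction z with
  | zero => simp only [LinearMap.zero_apply, LinearMap.map_zero]
  | add z z' hz hz' => simp only [LinearMap.map_add, LinearMap.add_apply, hz, hz']
  | tmul d t =>
  induction w with
  | zero => simp only [LinearMap.map_zero]
  | add w w' hw hw' => simp only [LinearMap.map_add, hw, hw']
  | tmul e m =>
  have h := congrArg (fun z => (c * d * e * a) ⊗ₜ[k] z) (h s t m)
  simp only [tmul_add] at h
  simp only [hM c d s t, hM d e t m, LinearMap.map_add, LinearMap.add_apply, hM _ _ _ _, h₁, h₂,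
    tmul_zero, add_zero]
  simp only [_root_.mul_assoc, ha] at h ⊢
  simp only [add_assoc, h]

theorem counit_mul (hM : IsDeformation a μ M) (ha : counit (R := k) a = 0) (y z : A ⊗[k] H) :
    counit (R := k) (M y z) = counit (R := k) y * counit (R := k) z := by
  induction y with
  | zero => simp only [LinearMap.zero_apply, LinearMap.map_zero, zero_mul]
  | add y y' hy hy' => simp only [LinearMap.map_add, LinearMap.add_apply, hy, hy', add_mul]
  | tmul c s =>
  induction z with
  | zero => simp only [LinearMap.map_zero, mul_zero]
  | add z z' hz hz' => simp only [LinearMap.map_add, hz, hz', mul_add]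
  | tmul d t =>
  simp only [hM _ _ _ _, map_add, counit_tmul, Bialgebra.counit_mul, ha, mul_zero,
    add_zero, smul_eq_mul]
  ring

/-- The product of two elements of `(A ⊗ H) ⊗ (A ⊗ H)` with the multiplication `M` in both factors,
in terms of the products of `A ⊗ A` and `H ⊗ H`. -/
theorem map₂_shuffle (hM : IsDeformation a μ M) (p q : A ⊗[k] A) (P Q : H ⊗[k] H) :
    map₂ M M (shuffle k A H (p ⊗ₜ P)) (shuffle k A H (q ⊗ₜ Q)) =
      shuffle k A H ((p * q) ⊗ₜ (P * Q) +
          (p * q * (a ⊗ₜ 1)) ⊗ₜ map₂ μ (LinearMap.mul k _) P Q +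
          (p * q * (1 ⊗ₜ a)) ⊗ₜ map₂ (LinearMap.mul k _) μ P Q +
          (p * q * (a ⊗ₜ a)) ⊗ₜ map₂ μ μ P Q) := by
  induction p with
  | zero => simp only [zero_tmul, LinearMap.map_zero, LinearMap.zero_apply, zero_mul, add_zero]
  | add y z hy hz =>
    simp only [add_tmul, LinearMap.map_add, LinearMap.add_apply, hy, hz, add_mul]
    abel
  | tmul p p' =>
  induction q with
  | zero => simp only [zero_tmul, LinearMap.map_zero, mul_zero, zero_mul, add_zero]
  | add y z hy hz =>
    simp only [add_tmul, LinearMap.map_add, hy, hz, add_mul, mul_add]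
    abel
  | tmul q q' =>
  induction P with
  | zero => simp only [tmul_zero, LinearMap.map_zero, LinearMap.zero_apply, zero_mul, add_zero]
  | add y z hy hz =>
    simp only [tmul_add, LinearMap.map_add, LinearMap.add_apply, hy, hz, add_mul]
    abel
  | tmul P P' =>
  induction Q with
  | zero => simp only [tmul_zero, LinearMap.map_zero, mul_zero, add_zero]
  | add y z hy hz =>
    simp only [tmul_add, LinearMap.map_add, hy, hz, mul_add]
    abel
  | tmul Q Q' =>
  simp only [LinearEquiv.coe_coe, tensorTensorTensorComm_tmul, map₂_apply_tmul,
    TensorProduct.map_tmul, hM _ _ _ _, tmul_add, add_tmul, map_add,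
    Algebra.TensorProduct.tmul_mul_tmul, _root_.mul_one,
    LinearMap.mul_apply']
  abel

/-- Since `a` is primitive, the part linear in `a` splits into two terms, which are matched by `h₁`
and `h₂`; the quadratic part vanishes by `h₃`. -/
theorem comul_mul (hM : IsDeformation a μ M) (ha : comul (R := k) a = a ⊗ₜ[k] 1 + 1 ⊗ₜ[k] a)
    (h₁ : ∀ s t : H, comul (R := k) (μ s t) =
      map₂ μ (LinearMap.mul k _) (comul (R := k) s) (comul (R := k) t))
    (h₂ : ∀ s t : H, comul (R := k) (μ s t) =
      map₂ (LinearMap.mul k _) μ (comul (R := k) s) (comul (R := k) t))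
    (h₃ : ∀ s t : H, map₂ μ μ (comul (R := k) s) (comul (R := k) t) = 0) (y z : A ⊗[k] H) :
    comul (R := k) (M y z) = map₂ M M (comul (R := k) y) (comul (R := k) z) := by
  induction y with
  | zero => simp only [LinearMap.zero_apply, LinearMap.map_zero]
  | add y y' hy hy' => simp only [LinearMap.map_add, LinearMap.add_apply, hy, hy']
  | tmul c s =>
  induction z with
  | zero => simp only [LinearMap.map_zero]
  | add z z' hz hz' => simp only [LinearMap.map_add, hz, hz']
  | tmul d t =>
  rw [comul_tmul_eq_shuffle, comul_tmul_eq_shuffle, hM.map₂_shuffle, h₃, ← h₁, ← h₂, hM,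
    LinearMap.map_add, comul_tmul_eq_shuffle, comul_tmul_eq_shuffle, tmul_zero, add_zero,
    Bialgebra.comul_mul (c * d), Bialgebra.comul_mul c, Bialgebra.comul_mul s, ha, mul_add,
    add_tmul, ← LinearMap.map_add, add_assoc]

theorem lift_shuffle (hM : IsDeformation a μ M) (p : A ⊗[k] A) (P : H ⊗[k] H) :
    TensorProduct.lift M (shuffle k A H (p ⊗ₜ P)) =
      LinearMap.mul' k A p ⊗ₜ LinearMap.mul' k H P +
        (LinearMap.mul' k A p * a) ⊗ₜ TensorProduct.lift μ P := by
  induction p with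
  | zero => simp only [zero_tmul, LinearMap.map_zero, zero_mul, add_zero]
  | add y z hy hz =>
    simp only [add_tmul, LinearMap.map_add, hy, hz, add_mul]
    abel
  | tmul p p' =>
  induction P with
  | zero => simp only [tmul_zero, LinearMap.map_zero, add_zero]
  | add y z hy hz =>
    simp only [tmul_add, LinearMap.map_add, hy, hz]
    abel
  | tmul P P' =>
  simp only [LinearEquiv.coe_coe, tensorTensorTensorComm_tmul, lift.tmul, hM _ _ _ _,
    LinearMap.mul'_apply]

theorem map_rTensor_shuffle (f : A →ₗ[k] A) (h : H →ₗ[k] H) (p : A ⊗[k] A) (P : H ⊗[k] H) :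
    (TensorProduct.map f h).rTensor _ (shuffle k A H (p ⊗ₜ P)) =
      shuffle k A H (f.rTensor _ p ⊗ₜ h.rTensor _ P) := by
  simpa [LinearMap.rTensor] using
    LinearMap.congr_fun (tensorTensorTensorComm_comp_map (R := k) f .id h .id).symm (p ⊗ₜ P)

theorem map_lTensor_shuffle (f : A →ₗ[k] A) (h : H →ₗ[k] H) (p : A ⊗[k] A) (P : H ⊗[k] H) :
    (TensorProduct.map f h).lTensor _ (shuffle k A H (p ⊗ₜ P)) =
      shuffle k A H (f.lTensor _ p ⊗ₜ h.lTensor _ P) := by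
  simpa [LinearMap.lTensor] using
    LinearMap.congr_fun (tensorTensorTensorComm_comp_map (R := k) .id f .id h).symm (p ⊗ₜ P)

/-- The tensor product of the antipodes is an antipode for the deformed multiplication. -/
theorem map_antipode (hM : IsDeformation a μ M)
    (h : ∀ s : H, TensorProduct.lift μ ((HopfAlgebra.antipode k).rTensor _ (comul (R := k) s)) = 0 ∧
      TensorProduct.lift μ ((HopfAlgebra.antipode k).lTensor _ (comul (R := k) s)) = 0)
    (z : A ⊗[k] H) :
    TensorProduct.lift M ((TensorProduct.map (HopfAlgebra.antipode k)
        (HopfAlgebra.antipode k)).rTensor (A ⊗[k] H) (comul (R := k) z)) =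
          counit (R := k) z • (1 ⊗ₜ 1) ∧
      TensorProduct.lift M ((TensorProduct.map (HopfAlgebra.antipode k)
        (HopfAlgebra.antipode k)).lTensor (A ⊗[k] H) (comul (R := k) z)) =
          counit (R := k) z • (1 ⊗ₜ 1) := by
  induction z with
  | zero => simp only [LinearMap.map_zero, zero_smul, and_self]
  | add y z hy hz => simp only [LinearMap.map_add, add_smul, hy.1, hy.2, hz.1, hz.2, and_self]
  | tmul c s =>
  rw [comul_tmul_eq_shuffle, map_rTensor_shuffle, map_lTensor_shuffle, hM.lift_shuffle,
    hM.lift_shuffle, (h s).1, (h s).2]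
  simp [Algebra.algebraMap_eq_smul_one, smul_tmul, tmul_smul, smul_smul, mul_comm]

end IsDeformation

end Deformation

section SweedlerSystem

variable {k A : Type*} [Field k] [Ring A] [HopfAlgebra k A]

open SweedlerH4

theorem sweedlerCocycle_tmul (a : A) (h l : SweedlerH4 k) : sweedlerCocycle a (h ⊗ₜ l) =
    ((h.re + h.imI) * (l.re + l.imI)) • (1 : A) + ((h.imJ + h.imK) * (l.imJ - l.imK)) • a := rfl

theorem cocycleMulMap_sweedlerCocycle (a : A) (s t : SweedlerH4 k) :
    cocycleMulMap (sweedlerCocycle a) (s ⊗ₜ t) =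
      (1 : A) ⊗ₜ (s * t) + a ⊗ₜ deform k s t := by
  suffices h : TensorProduct.curry (cocycleMulMap (sweedlerCocycle a)) =
      (LinearMap.mul k (SweedlerH4 k)).compr₂ (TensorProduct.mk k A _ 1) +
        (deform k).compr₂ (TensorProduct.mk k A _ a) from LinearMap.congr_fun₂ h s t
  refine bilin_ext k ?_
  rintro s (rfl | rfl | rfl | rfl) t (rfl | rfl | rfl | rfl) <;>
    simp [cocycleMulMap, comul_one, comul_g, comul_x, comul_gx, -Bialgebra.comul_mul,
      -Bialgebra.comul_one, deform_one_left, deform_one_right, deform_g_left, deform_g_right,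
      deform_x_x, deform_gx_x, deform_x_gx, deform_gx_gx, g_mul_g, x_mul_g, x_mul_x, gx_mul_gx,
      gx_mul_x, x_mul_gx, g_mul_gx, gx_mul_g, tmul_add, add_tmul,
      sweedlerCocycle_tmul, TensorProduct.tmul_neg] <;>
    simp [g, x, TensorProduct.neg_tmul]

/-- The multiplication of the deformed tensor product `A ⊗ H₄`:
`(c ⊗ s)(d ⊗ t) = cd ⊗ st + cda ⊗ μ(s, t)`. -/
theorem crossedMul_sweedlerCocycle (a c d : A) (s t : SweedlerH4 k) :
    crossedMul (trivialAction k (SweedlerH4 k) A) (sweedlerCocycle a) (c ⊗ₜ s) (d ⊗ₜ t) =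
      (c * d) ⊗ₜ (s * t) + (c * d * a) ⊗ₜ deform k s t := by
  rw [crossedMul_tmul_left, crossedActMap_trivialAction, cocycleMulMap_sweedlerCocycle]
  simp [tmul_add, leftMulMap_tmul, mul_assoc]

theorem isDeformation_sweedlerCocycle (a : A) : IsDeformation a (deform k)
    (crossedMul (trivialAction k (SweedlerH4 k) A) (sweedlerCocycle a)) :=
  crossedMul_sweedlerCocycle a

variable (k) in
/-- The crossed system (trivial action, `f_a`) of a central primitive element `a`. -/
def sweedlerSystem (a : CentralPrimitive k A) : CrossedSystem k A (SweedlerH4 k) where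
  act := trivialAction k (SweedlerH4 k) A
  cocycle := sweedlerCocycle a.1
  weak := isWeakAction_trivialAction
  one_mul := (isDeformation_sweedlerCocycle a.1).one_mul (deform_one_left k)
  mul_one := (isDeformation_sweedlerCocycle a.1).mul_one (deform_one_right k)
  mul_assoc := (isDeformation_sweedlerCocycle a.1).mul_assoc a.2.2 (deform_assoc k)
    (deform_deform_left k) (deform_deform_right k)
  counit_mul := (isDeformation_sweedlerCocycle a.1).counit_mul
    (counit_eq_zero_of_primitive a.2.1)
  comul_mul := (isDeformation_sweedlerCocycle a.1).comul_mul a.2.1 (comul_deform_left k)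
    (comul_deform_right k) (map_deform_deform k)
  exists_antipode := ⟨_, (isDeformation_sweedlerCocycle a.1).map_antipode (lift_deform_antipode k)⟩

end SweedlerSystem

/-! ### Projections of a crossed product -/

section TensorProjections

theorem Coalgebra.sum_counit_smul_left {R C ι : Type*} [CommSemiring R] [AddCommMonoid C]
    [Module R C] [Coalgebra R C] {c : C} (r : Coalgebra.Repr R c ι) :
    ∑ i ∈ r.index, counit (R := R) (r.right i) • r.left i = c := by
  have h := congrArg (_root_.TensorProduct.rid R C) (sum_tmul_counit_eq r)
  simpa only [map_sum, _root_.TensorProduct.rid_tmul, one_smul] using h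

variable {k A H : Type*} [Field k] [Ring A] [HopfAlgebra k A] [Ring H] [HopfAlgebra k H]

variable (k A H) in
/-- The projection `c ⊗ h ↦ ε(h) c`. -/
def tensorFst : A ⊗[k] H →ₗ[k] A :=
  (TensorProduct.rid k A).toLinearMap ∘ₗ (counit (R := k) (A := H)).lTensor A

variable (k A H) in
/-- The projection `c ⊗ h ↦ ε(c) h`. -/
def tensorSnd : A ⊗[k] H →ₗ[k] H :=
  (TensorProduct.lid k H).toLinearMap ∘ₗ (counit (R := k) (A := A)).rTensor H

theorem tensorFst_tmul (c : A) (h : H) : tensorFst k A H (c ⊗ₜ h) = counit (R := k) h • c := by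
  simp [tensorFst]

theorem tensorSnd_tmul (c : A) (h : H) : tensorSnd k A H (c ⊗ₜ h) = counit (R := k) c • h := by
  simp [tensorSnd]

theorem counit_tensorFst (z : A ⊗[k] H) :
    counit (R := k) (tensorFst k A H z) = counit (R := k) z := by
  induction z with
  | zero => simp only [map_zero]
  | add y z hy hz => simp only [map_add, hy, hz]
  | tmul c h => simp [tensorFst_tmul]

/-- An element of `A ⊗ H` is recovered from its comultiplication: `z = ∑ π_A(z₁) ⊗ π_H(z₂)`. -/
theorem map_tensorFst_tensorSnd_comul (z : A ⊗[k] H) :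
    TensorProduct.map (tensorFst k A H) (tensorSnd k A H) (comul (R := k) z) = z := by
  induction z with
  | zero => simp only [map_zero]
  | add y z hy hz => simp only [map_add, hy, hz]
  | tmul c h =>
    rw [comul_tmul_eq_shuffle]
    conv_rhs => rw [← sum_counit_smul_left (ℛ k c), ← sum_counit_smul (ℛ k h)]
    rw [← (ℛ k c).eq, ← (ℛ k h).eq]
    simp only [sum_tmul, tmul_sum, map_sum, LinearEquiv.coe_coe, tensorTensorTensorComm_tmul,
      TensorProduct.map_tmul, tensorFst_tmul, tensorSnd_tmul, smul_tmul_smul]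
    simp only [mul_comm]

/-- The components also commute: `z` is the flip of `∑ π_H(z₁) ⊗ π_A(z₂)`. -/
theorem map_tensorSnd_tensorFst_comul (z : A ⊗[k] H) :
    TensorProduct.map (tensorSnd k A H) (tensorFst k A H) (comul (R := k) z) =
      TensorProduct.comm k A H z := by
  induction z with
  | zero => simp only [map_zero]
  | add y z hy hz => simp only [map_add, hy, hz]
  | tmul c h =>
    rw [comul_tmul_eq_shuffle]
    conv_rhs => rw [← sum_counit_smul (ℛ k c), ← sum_counit_smul_left (ℛ k h)]
    rw [← (ℛ k c).eq, ← (ℛ k h).eq]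
    simp only [sum_tmul, tmul_sum, map_sum, LinearEquiv.coe_coe, tensorTensorTensorComm_tmul,
      TensorProduct.map_tmul, tensorFst_tmul, tensorSnd_tmul, smul_tmul_smul,
      map_smul, TensorProduct.comm_tmul]

theorem map_tensorFst_tensorFst_comul (z : A ⊗[k] H) :
    TensorProduct.map (tensorFst k A H) (tensorFst k A H) (comul (R := k) z) =
      comul (R := k) (tensorFst k A H z) := by
  induction z with
  | zero => simp only [map_zero]
  | add y z hy hz => simp only [map_add, hy, hz]
  | tmul c h =>
    have e := congrArg (counit (R := k)) (sum_counit_smul (ℛ k h))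
    rw [comul_tmul_eq_shuffle, tensorFst_tmul, map_smul, ← (ℛ k c).eq, ← e]
    nth_rw 1 [← (ℛ k h).eq]
    simp only [sum_tmul, tmul_sum, map_sum, LinearEquiv.coe_coe, tensorTensorTensorComm_tmul,
      TensorProduct.map_tmul, tensorFst_tmul, smul_tmul_smul, map_smul, Finset.sum_smul,
      Finset.smul_sum, smul_eq_mul]
    rw [Finset.sum_comm]

theorem map_tensorSnd_tensorSnd_comul (z : A ⊗[k] H) :
    TensorProduct.map (tensorSnd k A H) (tensorSnd k A H) (comul (R := k) z) =
      comul (R := k) (tensorSnd k A H z) := by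
  induction z with
  | zero => simp only [map_zero]
  | add y z hy hz => simp only [map_add, hy, hz]
  | tmul c h =>
    have e := congrArg (counit (R := k)) (sum_counit_smul (ℛ k c))
    rw [comul_tmul_eq_shuffle, tensorSnd_tmul, map_smul, ← (ℛ k h).eq, ← e]
    nth_rw 1 [← (ℛ k c).eq]
    simp only [sum_tmul, tmul_sum, map_sum, LinearEquiv.coe_coe, tensorTensorTensorComm_tmul,
      TensorProduct.map_tmul, tensorSnd_tmul, smul_tmul_smul, map_smul, Finset.sum_smul,
      Finset.smul_sum, smul_eq_mul]

theorem counit_tensorSnd (z : A ⊗[k] H) :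
    counit (R := k) (tensorSnd k A H z) = counit (R := k) z := by
  induction z with
  | zero => simp only [map_zero]
  | add y z hy hz => simp only [map_add, hy, hz]
  | tmul c h => simp [tensorSnd_tmul, mul_comm]

theorem tensorFst_leftMulMap (c : A) (z : A ⊗[k] H) :
    tensorFst k A H (leftMulMap k A H (c ⊗ₜ z)) = c * tensorFst k A H z := by
  induction z with
  | zero => simp only [tmul_zero, map_zero, mul_zero]
  | add y z hy hz => simp only [tmul_add, map_add, mul_add, hy, hz]
  | tmul d h => rw [leftMulMap_tmul, tensorFst_tmul, tensorFst_tmul, mul_smul_comm]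

theorem tensorSnd_leftMulMap (c : A) (z : A ⊗[k] H) :
    tensorSnd k A H (leftMulMap k A H (c ⊗ₜ z)) = counit (R := k) c • tensorSnd k A H z := by
  induction z with
  | zero => simp only [tmul_zero, map_zero, smul_zero]
  | add y z hy hz => simp only [tmul_add, map_add, smul_add, hy, hz]
  | tmul d h =>
    rw [leftMulMap_tmul, tensorSnd_tmul, tensorSnd_tmul, Bialgebra.counit_mul, mul_smul]

theorem leftMulMap_one (z : A ⊗[k] H) : leftMulMap k A H (1 ⊗ₜ z) = z := by
  induction z with
  | zero => simp only [tmul_zero, map_zero]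
  | add y z hy hz => simp only [tmul_add, map_add, hy, hz]
  | tmul d h => rw [leftMulMap_tmul, one_mul]

theorem tensorFst_cocycleMulMap (f : H ⊗[k] H →ₗ[k] A) (h l : H) :
    tensorFst k A H (cocycleMulMap f (h ⊗ₜ l)) = f (h ⊗ₜ l) := by
  have e : tensorFst k A H ∘ₗ TensorProduct.map f (LinearMap.mul' k H) =
      f ∘ₗ (TensorProduct.rid k _).toLinearMap ∘ₗ
        (counit (R := k) (A := H ⊗[k] H)).lTensor _ := by
    ext a b c d
    simp [tensorFst_tmul, mul_comm]
  rw [cocycleMulMap, ← LinearMap.comp_apply, ← LinearMap.comp_assoc, e, LinearMap.comp_apply,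
    LinearMap.comp_apply, LinearMap.comp_apply, lTensor_counit_comul]
  simp

theorem tensorFst_crossedActMap (act : H ⊗[k] A →ₗ[k] A) (f : H ⊗[k] H →ₗ[k] A) (d : A) (h l : H) :
    tensorFst k A H (crossedActMap act f (h ⊗ₜ (d ⊗ₜ l))) = ∑ i ∈ (ℛ k h).index,
      act ((ℛ k h).left i ⊗ₜ d) * f ((ℛ k h).right i ⊗ₜ l) := by
  simp only [crossedActMap, LinearMap.comp_apply, LinearMap.rTensor_tmul, LinearEquiv.coe_coe]
  nth_rw 1 [← (ℛ k h).eq]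
  simp only [sum_tmul, map_sum, tensorTensorTensorComm_tmul, TensorProduct.map_tmul,
    tensorFst_leftMulMap, tensorFst_cocycleMulMap]

end TensorProjections

namespace CrossedSystem

variable {k A H : Type*} [Field k] [Ring A] [HopfAlgebra k A] [Ring H] [HopfAlgebra k H]
  (S : CrossedSystem k A H)

/-- The cocycle is the first component of the product of `1 # h` and `1 # l`. -/
theorem cocycle_eq_tensorFst (h l : H) : S.cocycle (h ⊗ₜ l) =
    tensorFst k A H (crossedMul S.act S.cocycle (1 ⊗ₜ h) (1 ⊗ₜ l)) := by
  rw [crossedMul_tmul_left, leftMulMap_one, tensorFst_crossedActMap]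
  conv_lhs => rw [← sum_counit_smul (ℛ k h)]
  simp [S.weak.act_one, sum_tmul, ← smul_tmul']

theorem cocycle_tmul_one (h : H) : S.cocycle (h ⊗ₜ 1) = counit (R := k) h • (1 : A) := by
  rw [cocycle_eq_tensorFst, S.mul_one, tensorFst_tmul]

/-- The action is the first component of the product of `1 # h` and `c # 1`. -/
theorem act_eq_tensorFst (h : H) (c : A) : S.act (h ⊗ₜ c) =
    tensorFst k A H (crossedMul S.act S.cocycle (1 ⊗ₜ h) (c ⊗ₜ 1)) := by
  rw [crossedMul_tmul_left, leftMulMap_one, tensorFst_crossedActMap]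
  conv_lhs => rw [← sum_counit_smul_left (ℛ k h)]
  simp [cocycle_tmul_one, sum_tmul, ← smul_tmul']

theorem counit_cocycle (h l : H) : counit (R := k) (S.cocycle (h ⊗ₜ l)) =
    counit (R := k) h * counit (R := k) l := by
  rw [cocycle_eq_tensorFst, counit_tensorFst, S.counit_mul]
  simp

theorem counit_act (h : H) (c : A) : counit (R := k) (S.act (h ⊗ₜ c)) =
    counit (R := k) h * counit (R := k) c := by
  rw [act_eq_tensorFst, counit_tensorFst, S.counit_mul]
  simp

theorem tensorSnd_cocycleMulMap (h l : H) :
    tensorSnd k A H (cocycleMulMap S.cocycle (h ⊗ₜ l)) = h * l := by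
  have e : tensorSnd k A H ∘ₗ TensorProduct.map S.cocycle (LinearMap.mul' k H) =
      LinearMap.mul' k H ∘ₗ (TensorProduct.lid k _).toLinearMap ∘ₗ
        (counit (R := k) (A := H ⊗[k] H)).rTensor _ := by
    ext a b c d
    simp [tensorSnd_tmul, counit_cocycle, mul_comm]
  rw [cocycleMulMap, ← LinearMap.comp_apply, ← LinearMap.comp_assoc, e, LinearMap.comp_apply,
    LinearMap.comp_apply, LinearMap.comp_apply, rTensor_counit_comul]
  simp

/-- The projection of a crossed product onto `H` is multiplicative. -/
theorem tensorSnd_crossedMul (y z : A ⊗[k] H) :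
    tensorSnd k A H (crossedMul S.act S.cocycle y z) =
      tensorSnd k A H y * tensorSnd k A H z := by
  induction y with
  | zero => simp only [map_zero, LinearMap.zero_apply, zero_mul]
  | add y y' hy hy' => simp only [map_add, LinearMap.add_apply, add_mul, hy, hy']
  | tmul c h =>
  induction z with
  | zero => simp only [map_zero, mul_zero]
  | add z z' hz hz' => simp only [map_add, mul_add, hz, hz']
  | tmul d l =>
  rw [crossedMul_tmul_left, tensorSnd_leftMulMap, tensorSnd_tmul, tensorSnd_tmul, smul_mul_assoc,
    mul_smul_comm]
  congr 1
  simp only [crossedActMap, LinearMap.comp_apply, LinearMap.rTensor_tmul, LinearEquiv.coe_coe]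
  conv_rhs => rw [← sum_counit_smul (ℛ k h)]
  rw [← (ℛ k h).eq]
  simp only [sum_tmul, map_sum, tensorTensorTensorComm_tmul, TensorProduct.map_tmul,
    tensorSnd_leftMulMap, tensorSnd_cocycleMulMap, counit_act, Finset.sum_mul, Finset.smul_sum,
    smul_mul_assoc, smul_smul]
  simp only [mul_comm]

/-- The identity map from the crossed product to its underlying vector space, used to keep the two
multiplications on `A ⊗ H` apart. -/
def toTensor : S.Product ≃ₗ[k] A ⊗[k] H := LinearEquiv.refl k (A ⊗[k] H)

theorem comul_toTensor (z : S.Product) : comul (R := k) (S.toTensor z) =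
    TensorProduct.map S.toTensor.toLinearMap S.toTensor.toLinearMap (comul (R := k) z) :=
  (LinearMap.congr_fun (TensorProduct.map_id (R := k) (M := A ⊗[k] H) (N := A ⊗[k] H)) _).symm

theorem counit_toTensor (z : S.Product) : counit (R := k) (S.toTensor z) = counit (R := k) z := rfl

/-- The projection `c # h ↦ ε(h) c` of a crossed product onto its first factor. -/
def projLeft : S.Product →ₗ[k] A := tensorFst k A H ∘ₗ S.toTensor.toLinearMap

theorem map_projLeft_projLeft_comul (z : S.Product) :
    TensorProduct.map S.projLeft S.projLeft (comul (R := k) z) = comul (R := k) (S.projLeft z) := by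
  rw [projLeft, TensorProduct.map_comp, LinearMap.comp_apply, ← comul_toTensor,
    map_tensorFst_tensorFst_comul]
  rfl

/-- The Hopf algebra map `c # h ↦ ε(c) h` of a crossed product onto its second factor. -/
def projRight : S.Product →ₐc[k] H :=
  .ofAlgHom
    (.ofLinearMap (tensorSnd k A H ∘ₗ S.toTensor.toLinearMap)
      ((tensorSnd_tmul (k := k) (1 : A) (1 : H)).trans (by simp))
      fun y z => S.tensorSnd_crossedMul (S.toTensor y) (S.toTensor z))
    (by ext z; exact counit_tensorSnd (S.toTensor z))
    (by
      ext z
      refine Eq.trans ?_ (map_tensorSnd_tensorSnd_comul (S.toTensor z))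
      rw [comul_toTensor, ← LinearMap.comp_apply, ← TensorProduct.map_comp]
      rfl)

theorem projRight_toLinearMap :
    (S.projRight : S.Product →ₗ[k] H) = tensorSnd k A H ∘ₗ S.toTensor.toLinearMap := rfl

theorem projRight_apply (z : S.Product) : S.projRight z = tensorSnd k A H (S.toTensor z) := rfl

theorem projLeft_apply (z : S.Product) : S.projLeft z = tensorFst k A H (S.toTensor z) := rfl

/-- `z = ∑ π_A(z₁) # π_H(z₂)` in a crossed product. Together with `map_projRight_projLeft_comul`,
which gives the same element with the two tensor factors of the comultiplication exchanged, this
encodes the cocentrality of the action and of the cocycle. -/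
theorem map_projLeft_projRight_comul (z : S.Product) :
    TensorProduct.map S.projLeft (S.projRight : S.Product →ₗ[k] H) (comul (R := k) z) =
      S.toTensor z := by
  rw [projLeft, projRight_toLinearMap, TensorProduct.map_comp, LinearMap.comp_apply,
    ← comul_toTensor, map_tensorFst_tensorSnd_comul]

theorem map_projRight_projLeft_comul (z : S.Product) :
    TensorProduct.map (S.projRight : S.Product →ₗ[k] H) S.projLeft (comul (R := k) z) =
      TensorProduct.comm k A H (S.toTensor z) := by
  rw [projLeft, projRight_toLinearMap, TensorProduct.map_comp, LinearMap.comp_apply,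
    ← comul_toTensor, map_tensorSnd_tensorFst_comul]

/-- The map `h ↦ 1 # h`. -/
def sec : H →ₗ[k] S.Product := S.toTensor.symm.toLinearMap ∘ₗ TensorProduct.mk k A H 1

theorem toTensor_sec (h : H) : S.toTensor (S.sec h) = 1 ⊗ₜ h := rfl

theorem sec_one : S.sec 1 = 1 := rfl

theorem toTensor_one : S.toTensor 1 = 1 ⊗ₜ 1 := rfl

theorem shuffle_mk_right (p : A ⊗[k] A) : shuffle k A H (p ⊗ₜ (1 ⊗ₜ 1)) =
    TensorProduct.map ((TensorProduct.mk k A H).flip 1) ((TensorProduct.mk k A H).flip 1) p := by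
  induction p with
  | zero => simp only [zero_tmul, map_zero]
  | add y z hy hz => simp only [add_tmul, map_add, hy, hz]
  | tmul p q => rfl

theorem shuffle_mk_left (p : H ⊗[k] H) : shuffle k A H ((1 ⊗ₜ 1) ⊗ₜ p) =
    TensorProduct.map (TensorProduct.mk k A H 1) (TensorProduct.mk k A H 1) p := by
  induction p with
  | zero => simp only [tmul_zero, map_zero]
  | add y z hy hz => simp only [tmul_add, map_add, hy, hz]
  | tmul p q => rfl

theorem tmul_one_crossedMul (c : A) (z : A ⊗[k] H) :
    crossedMul S.act S.cocycle (c ⊗ₜ 1) z = leftMulMap k A H (c ⊗ₜ z) := by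
  have e := S.one_mul z
  rw [crossedMul_tmul_left, leftMulMap_one] at e
  rw [crossedMul_tmul_left, e]

/-- The embedding `c ↦ c # 1` of Hopf algebras. -/
def incl : A →ₐc[k] S.Product :=
  .ofAlgHom
    (.ofLinearMap (S.toTensor.symm.toLinearMap ∘ₗ (TensorProduct.mk k A H).flip 1) rfl
      fun c d => ((S.tmul_one_crossedMul c (d ⊗ₜ 1)).trans (leftMulMap_tmul c d 1)).symm)
    (by
      ext c
      exact (counit_tmul (R := k) (S := k) c (1 : H)).trans (by simp))
    (by
      ext c
      refine Eq.trans ?_ (comul_tmul_eq_shuffle c (1 : H)).symm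
      rw [Bialgebra.comul_one, Algebra.TensorProduct.one_def, shuffle_mk_right]
      rfl)

theorem toTensor_incl (c : A) : S.toTensor (S.incl c) = c ⊗ₜ 1 := rfl

theorem toTensor_incl_mul (c : A) (z : S.Product) :
    S.toTensor (S.incl c * z) = leftMulMap k A H (c ⊗ₜ S.toTensor z) :=
  S.tmul_one_crossedMul c (S.toTensor z)

theorem toTensor_incl_mul_sec (c : A) (h : H) : S.toTensor (S.incl c * S.sec h) = c ⊗ₜ h := by
  rw [toTensor_incl_mul, toTensor_sec, leftMulMap_tmul, _root_.mul_one]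

theorem cocycle_eq (h l : H) : S.cocycle (h ⊗ₜ l) = S.projLeft (S.sec h * S.sec l) :=
  S.cocycle_eq_tensorFst h l

theorem act_eq (h : H) (c : A) : S.act (h ⊗ₜ c) = S.projLeft (S.sec h * S.incl c) :=
  S.act_eq_tensorFst h c

theorem projLeft_incl_mul (c : A) (z : S.Product) :
    S.projLeft (S.incl c * z) = c * S.projLeft z := by
  rw [projLeft_apply, toTensor_incl_mul, tensorFst_leftMulMap, projLeft_apply]

theorem projLeft_incl (c : A) : S.projLeft (S.incl c) = c := by
  rw [projLeft_apply, toTensor_incl, tensorFst_tmul, Bialgebra.counit_one, one_smul]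

theorem incl_injective : Function.Injective S.incl :=
  Function.LeftInverse.injective S.projLeft_incl

theorem projRight_incl (c : A) : S.projRight (S.incl c) = counit (R := k) c • (1 : H) :=
  tensorSnd_tmul c 1

theorem projLeft_sec (h : H) : S.projLeft (S.sec h) = counit (R := k) h • (1 : A) :=
  tensorFst_tmul 1 h

theorem projRight_sec (h : H) : S.projRight (S.sec h) = h := by
  rw [projRight_apply, toTensor_sec, tensorSnd_tmul, Bialgebra.counit_one, one_smul]

theorem projLeft_one : S.projLeft 1 = 1 := by
  rw [← sec_one, projLeft_sec, Bialgebra.counit_one, one_smul]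

theorem comul_sec (h : H) : comul (R := k) (S.sec h) =
    TensorProduct.map S.sec S.sec (comul (R := k) h) := by
  refine (comul_tmul_eq_shuffle 1 h).trans ?_
  rw [Bialgebra.comul_one, Algebra.TensorProduct.one_def, shuffle_mk_left]
  rfl

theorem comul_incl (c : A) : comul (R := k) (S.incl c) =
    ∑ i ∈ (ℛ k c).index, S.incl ((ℛ k c).left i) ⊗ₜ[k] S.incl ((ℛ k c).right i) := by
  rw [← CoalgHomClass.map_comp_comul_apply]
  nth_rw 1 [← (ℛ k c).eq]
  simp

theorem map_projLeft_projRight_mul_comul_incl (y z : S.Product) (c : A) :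
    TensorProduct.map S.projLeft (S.projRight : S.Product →ₗ[k] H)
        ((y ⊗ₜ z) * comul (R := k) (S.incl c)) =
      S.projLeft (y * S.incl c) ⊗ₜ S.projRight z := by
  conv_rhs => rw [← sum_counit_smul_left (ℛ k c)]
  rw [comul_incl]
  simp [Finset.mul_sum, projRight_incl, sum_tmul, tmul_smul, smul_tmul']

theorem map_projRight_projLeft_mul_comul_incl (y z : S.Product) (c : A) :
    TensorProduct.map (S.projRight : S.Product →ₗ[k] H) S.projLeft
        ((y ⊗ₜ z) * comul (R := k) (S.incl c)) =
      S.projRight y ⊗ₜ S.projLeft (z * S.incl c) := by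
  conv_rhs => rw [← sum_counit_smul (ℛ k c)]
  rw [comul_incl]
  simp [Finset.mul_sum, projRight_incl, tmul_sum, tmul_smul, smul_tmul']

end CrossedSystem

/-! ### Classification of crossed systems for Sweedler's Hopf algebra -/

section Coefficients

variable {k A : Type*} [Field k] [Ring A] [HopfAlgebra k A]

open SweedlerH4

variable (A) in
/-- The coefficient map `c ⊗ h ↦ φ(h) c` of a linear functional `φ` on `H₄`. -/
def coeff (φ : SweedlerH4 k →ₗ[k] k) : A ⊗[k] SweedlerH4 k →ₗ[k] A :=
  (TensorProduct.rid k A).toLinearMap ∘ₗ φ.lTensor A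

theorem coeff_tmul (φ : SweedlerH4 k →ₗ[k] k) (c : A) (h : SweedlerH4 k) :
    coeff A φ (c ⊗ₜ h) = φ h • c := by
  simp [coeff]

/-- Comparison of the coefficients at `1`, `g` and `gx`. -/
theorem eq_of_tmul_g_add_tmul_gx {c d : A}
    (h : c ⊗ₜ[k] g k + d ⊗ₜ[k] (g k * x k) = c ⊗ₜ[k] 1 + 1 ⊗ₜ[k] (g k * x k)) :
    c = 0 ∧ d = 1 := by
  have h1 := congrArg (coeff A (QuaternionAlgebra.imIₗ 1 0 0)) h
  have h2 := congrArg (coeff A (QuaternionAlgebra.imKₗ 1 0 0)) h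
  simp only [map_add, coeff_tmul] at h1 h2
  constructor
  · simpa [g, x] using h1
  · simpa [g, x] using h2

/-- Comparison of the coefficients at `1`, `g` and `x`. -/
theorem eq_of_tmul_one_add_tmul_x {c d e : A}
    (h : c ⊗ₜ[k] 1 + d ⊗ₜ[k] x k = e ⊗ₜ[k] x k + c ⊗ₜ[k] g k) : c = 0 ∧ d = e := by
  have h1 := congrArg (coeff A (QuaternionAlgebra.imIₗ 1 0 0)) h
  have h2 := congrArg (coeff A (QuaternionAlgebra.imJₗ 1 0 0)) h
  simp only [map_add, coeff_tmul] at h1 h2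
  constructor
  · simpa [g, x] using h1.symm
  · simpa [g, x] using h2

end Coefficients

namespace CrossedSystem

variable {k A : Type*} [Field k] [Ring A] [HopfAlgebra k A] (S : CrossedSystem k A (SweedlerH4 k))

open SweedlerH4

theorem comul_sec_g : comul (R := k) (S.sec (g k)) = S.sec (g k) ⊗ₜ S.sec (g k) := by
  rw [comul_sec, comul_g, TensorProduct.map_tmul]

theorem comul_sec_x : comul (R := k) (S.sec (x k)) =
    S.sec (x k) ⊗ₜ 1 + S.sec (g k) ⊗ₜ S.sec (x k) := by
  rw [comul_sec, comul_x, map_add, TensorProduct.map_tmul, TensorProduct.map_tmul, sec_one]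

theorem projLeft_sec_g : S.projLeft (S.sec (g k)) = 1 := by
  rw [projLeft_sec, counit_g k, one_smul]

/-- Both expressions of `(1 # x)(1 # g)` through the components of its comultiplication agree,
which forces `f(x, g) = 0` and `f(g, g) = 1`. -/
theorem projLeft_sec_x_mul_sec_g :
    S.projLeft (S.sec (x k) * S.sec (g k)) = 0 ∧ S.projLeft (S.sec (g k) * S.sec (g k)) = 1 := by
  have hc : comul (R := k) (S.sec (x k) * S.sec (g k)) =
      (S.sec (x k) * S.sec (g k)) ⊗ₜ S.sec (g k) +
        (S.sec (g k) * S.sec (g k)) ⊗ₜ (S.sec (x k) * S.sec (g k)) := by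
    rw [Bialgebra.comul_mul, comul_sec_g, comul_sec_x, add_mul,
      Algebra.TensorProduct.tmul_mul_tmul, Algebra.TensorProduct.tmul_mul_tmul, _root_.one_mul]
  have h1 := S.map_projLeft_projRight_comul (S.sec (x k) * S.sec (g k))
  have h2 := S.map_projRight_projLeft_comul (S.sec (x k) * S.sec (g k))
  rw [hc] at h1 h2
  simp only [map_add, TensorProduct.map_tmul, BialgHom.coe_toLinearMap, map_mul, projRight_sec,
    projLeft_sec_g, g_mul_g] at h1 h2
  rw [← h1] at h2
  simp only [map_add, TensorProduct.comm_tmul, x_mul_g, TensorProduct.neg_tmul,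
    TensorProduct.tmul_neg] at h2
  have h3 := congrArg (TensorProduct.comm k (SweedlerH4 k) A) h2
  simp only [map_add, map_neg, TensorProduct.comm_tmul] at h3
  have h4 := eq_of_tmul_g_add_tmul_gx
    (c := -S.projLeft (S.sec (x k) * S.sec (g k)))
    (d := S.projLeft (S.sec (g k) * S.sec (g k))) (k := k) (by
      rw [TensorProduct.neg_tmul, TensorProduct.neg_tmul]
      rw [← sub_eq_zero] at h3 ⊢
      rw [← h3]
      abel)
  exact ⟨neg_eq_zero.1 h4.1, h4.2⟩

theorem ext_toTensor {y z : S.Product} (h : S.toTensor y = S.toTensor z) : y = z :=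
  S.toTensor.injective h

theorem sec_g_mul_sec_g : S.sec (g k) * S.sec (g k) = 1 := by
  apply S.ext_toTensor
  rw [← map_projLeft_projRight_comul, Bialgebra.comul_mul, comul_sec_g,
    Algebra.TensorProduct.tmul_mul_tmul, TensorProduct.map_tmul, S.projLeft_sec_x_mul_sec_g.2,
    BialgHom.coe_toLinearMap, map_mul, projRight_sec, g_mul_g, toTensor_one]

theorem sec_x_mul_sec_g : S.sec (x k) * S.sec (g k) = -S.sec (g k * x k) := by
  apply S.ext_toTensor
  rw [← map_projLeft_projRight_comul, Bialgebra.comul_mul, comul_sec_g, comul_sec_x, add_mul,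
    Algebra.TensorProduct.tmul_mul_tmul, Algebra.TensorProduct.tmul_mul_tmul, map_add,
    TensorProduct.map_tmul, TensorProduct.map_tmul, S.projLeft_sec_x_mul_sec_g.1,
    S.projLeft_sec_x_mul_sec_g.2,
    TensorProduct.zero_tmul, zero_add, BialgHom.coe_toLinearMap, map_mul, projRight_sec,
    projRight_sec, x_mul_g, map_neg, toTensor_sec, TensorProduct.tmul_neg]

/-- As for `(1 # x)(1 # g)`, the two expressions of `(1 # g)(1 # x)` force `f(g, x) = 0`. -/
theorem sec_g_mul_sec_x : S.sec (g k) * S.sec (x k) = S.sec (g k * x k) := by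
  have hc : comul (R := k) (S.sec (g k) * S.sec (x k)) =
      (S.sec (g k) * S.sec (x k)) ⊗ₜ S.sec (g k) + 1 ⊗ₜ (S.sec (g k) * S.sec (x k)) := by
    rw [Bialgebra.comul_mul, comul_sec_g, comul_sec_x, mul_add,
      Algebra.TensorProduct.tmul_mul_tmul, Algebra.TensorProduct.tmul_mul_tmul, _root_.mul_one,
      sec_g_mul_sec_g]
  have h1 := S.map_projLeft_projRight_comul (S.sec (g k) * S.sec (x k))
  have h2 := S.map_projRight_projLeft_comul (S.sec (g k) * S.sec (x k))
  rw [hc] at h1 h2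
  simp only [map_add, TensorProduct.map_tmul, BialgHom.coe_toLinearMap, map_mul, map_one,
    projRight_sec, projLeft_sec_g, projLeft_one] at h1 h2
  rw [← h1] at h2
  have h3 := congrArg (TensorProduct.comm k (SweedlerH4 k) A) h2
  simp only [map_add, TensorProduct.comm_tmul] at h3
  have h4 := eq_of_tmul_g_add_tmul_gx (h3.symm.trans (add_comm _ _))
  apply S.ext_toTensor
  rw [← h1, h4.1, TensorProduct.zero_tmul, zero_add, toTensor_sec]

/-- Both expressions of `(1 # x)(c # 1)` through the components of its comultiplication agree,
which forces `g ▷ c = c` and `x ▷ c = 0`. -/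
theorem projLeft_sec_x_mul_incl (c : A) :
    S.projLeft (S.sec (x k) * S.incl c) = 0 ∧ S.projLeft (S.sec (g k) * S.incl c) = c := by
  have h1 := S.map_projLeft_projRight_comul (S.sec (x k) * S.incl c)
  have h2 := S.map_projRight_projLeft_comul (S.sec (x k) * S.incl c)
  rw [Bialgebra.comul_mul, comul_sec_x, add_mul, map_add, map_projLeft_projRight_mul_comul_incl,
    map_projLeft_projRight_mul_comul_incl] at h1
  rw [Bialgebra.comul_mul, comul_sec_x, add_mul, map_add, map_projRight_projLeft_mul_comul_incl,
    map_projRight_projLeft_mul_comul_incl, ← h1] at h2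
  have h3 := congrArg (TensorProduct.comm k (SweedlerH4 k) A) h2
  simp only [map_add, TensorProduct.comm_tmul, map_one, projRight_sec, _root_.one_mul,
    projLeft_incl] at h3
  exact eq_of_tmul_one_add_tmul_x h3.symm

theorem sec_g_mul_incl (c : A) : S.sec (g k) * S.incl c = S.incl c * S.sec (g k) := by
  apply S.ext_toTensor
  rw [toTensor_incl_mul_sec, ← map_projLeft_projRight_comul, Bialgebra.comul_mul, comul_sec_g,
    map_projLeft_projRight_mul_comul_incl, (S.projLeft_sec_x_mul_incl c).2, projRight_sec]

theorem sec_x_mul_incl (c : A) : S.sec (x k) * S.incl c = S.incl c * S.sec (x k) := by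
  apply S.ext_toTensor
  rw [toTensor_incl_mul_sec, ← map_projLeft_projRight_comul, Bialgebra.comul_mul, comul_sec_x,
    add_mul, map_add, map_projLeft_projRight_mul_comul_incl, map_projLeft_projRight_mul_comul_incl,
    (S.projLeft_sec_x_mul_incl c).1, (S.projLeft_sec_x_mul_incl c).2, projRight_sec,
    TensorProduct.zero_tmul, zero_add]

theorem sec_gx_mul_incl (c : A) :
    S.sec (g k * x k) * S.incl c = S.incl c * S.sec (g k * x k) := by
  rw [← sec_g_mul_sec_x, _root_.mul_assoc, sec_x_mul_incl, ← _root_.mul_assoc, sec_g_mul_incl,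
    _root_.mul_assoc]

/-- The element `a` of `A` with `(1 # x)² = a # 1`. -/
def param : A := S.projLeft (S.sec (x k) * S.sec (x k))

theorem comul_sec_x_mul_sec_x : comul (R := k) (S.sec (x k) * S.sec (x k)) =
    (S.sec (x k) * S.sec (x k)) ⊗ₜ 1 + 1 ⊗ₜ (S.sec (x k) * S.sec (x k)) := by
  rw [Bialgebra.comul_mul, comul_sec_x]
  simp only [mul_add, add_mul, Algebra.TensorProduct.tmul_mul_tmul, _root_.mul_one, _root_.one_mul,
    sec_x_mul_sec_g, sec_g_mul_sec_g, sec_g_mul_sec_x, TensorProduct.neg_tmul]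
  abel

theorem sec_x_mul_sec_x : S.sec (x k) * S.sec (x k) = S.incl S.param := by
  apply S.ext_toTensor
  rw [← map_projLeft_projRight_comul, comul_sec_x_mul_sec_x]
  simp [projRight_sec, x_mul_x, toTensor_incl, param]

variable {S} in
/-- `a` is central because `(1 # x)²` commutes with `A`. -/
theorem param_mul (c : A) : S.param * c = c * S.param := by
  apply S.incl_injective
  rw [map_mul, map_mul, ← sec_x_mul_sec_x, _root_.mul_assoc, sec_x_mul_incl, ← _root_.mul_assoc,
    sec_x_mul_incl,
    _root_.mul_assoc]

theorem comul_param : comul (R := k) S.param = S.param ⊗ₜ[k] 1 + 1 ⊗ₜ[k] S.param := by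
  rw [param, ← map_projLeft_projLeft_comul, comul_sec_x_mul_sec_x, map_add, TensorProduct.map_tmul,
    TensorProduct.map_tmul, projLeft_one]

/-- The central primitive element of a crossed system for `(A, H₄)`. -/
def centralPrimitive : CentralPrimitive k A := ⟨S.param, S.comul_param, param_mul⟩

theorem act_eq_trivialAction : S.act = trivialAction k (SweedlerH4 k) A := by
  have h (c : A) : S.act ∘ₗ (TensorProduct.mk k (SweedlerH4 k) A).flip c =
      trivialAction k (SweedlerH4 k) A ∘ₗ (TensorProduct.mk k (SweedlerH4 k) A).flip c := by
    apply linearMap_ext <;>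
      simp [act_eq, trivialAction_tmul, sec_one, sec_g_mul_incl, sec_x_mul_incl, sec_gx_mul_incl,
        projLeft_incl_mul, projLeft_sec, projLeft_incl, counit_g k, counit_x k]
  exact TensorProduct.ext' fun h' c => LinearMap.congr_fun (h c) h'

/-- The values of the cocycle on the basis are read off from the multiplication table of the
elements `1 # g`, `1 # x`, `1 # gx`. -/
theorem cocycle_eq_sweedlerCocycle : S.cocycle = sweedlerCocycle S.param := by
  have hgg := S.sec_g_mul_sec_g
  have hxg := S.sec_x_mul_sec_g
  have hgx := S.sec_g_mul_sec_x
  have hxx := S.sec_x_mul_sec_x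
  have hgi := S.sec_g_mul_incl S.param
  have hggx : S.sec (g k) * S.sec (g k * x k) = S.sec (x k) := by
    rw [← hgx, ← _root_.mul_assoc, hgg, _root_.one_mul]
  have hgxg : S.sec (g k * x k) * S.sec (g k) = -S.sec (x k) := by
    rw [← hgx, _root_.mul_assoc, hxg, mul_neg, hggx]
  have hgxx : S.sec (g k * x k) * S.sec (x k) = S.incl S.param * S.sec (g k) := by
    rw [← hgx, _root_.mul_assoc, hxx, hgi]
  have hxgx : S.sec (x k) * S.sec (g k * x k) = -(S.incl S.param * S.sec (g k)) := by
    rw [← hgx, ← _root_.mul_assoc, hxg, neg_mul, hgxx]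
  have hgxgx : S.sec (g k * x k) * S.sec (g k * x k) = -S.incl S.param := by
    nth_rw 1 [← hgx]
    rw [_root_.mul_assoc, hxgx, mul_neg, ← hgi, ← _root_.mul_assoc, hgg, _root_.one_mul]
  have h : TensorProduct.curry S.cocycle = TensorProduct.curry (sweedlerCocycle S.param) := by
    refine bilin_ext k ?_
    rintro s (rfl | rfl | rfl | rfl) t (rfl | rfl | rfl | rfl) <;>
      rw [TensorProduct.curry_apply, TensorProduct.curry_apply, cocycle_eq] <;>
      simp only [sec_one, _root_.one_mul, _root_.mul_one, hgg, hxg, hgx, hxx, hggx, hgxg, hgxx,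
        hxgx, hgxgx, projLeft_incl_mul, projLeft_sec, projLeft_incl, projLeft_one, map_neg, counit_g k,
        counit_x k, Bialgebra.counit_mul, sweedlerCocycle_tmul] <;>
      simp [g, x]
  exact TensorProduct.ext' fun s t => LinearMap.congr_fun₂ h s t

theorem sweedlerSystem_centralPrimitive : sweedlerSystem k S.centralPrimitive = S :=
  CrossedSystem.ext S.act_eq_trivialAction.symm S.cocycle_eq_sweedlerCocycle.symm

theorem param_sweedlerSystem (a : CentralPrimitive k A) : (sweedlerSystem k a).param = a.1 := by
  rw [param, ← cocycle_eq]
  change sweedlerCocycle a.1 _ = _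
  simp [sweedlerCocycle_tmul, x]

/-- Crossed systems for `(A, H₄)` correspond to central primitive elements of `A`. -/
def equivCentralPrimitive : CentralPrimitive k A ≃ CrossedSystem k A (SweedlerH4 k) where
  toFun a := sweedlerSystem k a
  invFun S := S.centralPrimitive
  left_inv a := Subtype.ext (param_sweedlerSystem a)
  right_inv S := S.sweedlerSystem_centralPrimitive

end CrossedSystem

/-! ### Cohomologous systems and isomorphisms of crossed products -/

section Cohomologous

variable {k A H : Type*} [Field k] [Ring A] [HopfAlgebra k A] [Ring H] [HopfAlgebra k H]

theorem isUnitaryCocentral_unit_comp_counit :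
    IsUnitaryCocentral (((Bialgebra.unitBialgHom k A).comp (Bialgebra.counitBialgHom k H) :
      H →ₐc[k] A) : H →ₗc[k] A) where
  map_one := map_one ((Bialgebra.unitBialgHom k A).comp (Bialgebra.counitBialgHom k H))
  cocentral h := by
    have hl : ((((Bialgebra.unitBialgHom k A).comp (Bialgebra.counitBialgHom k H) :
      H →ₐc[k] A) : H →ₗc[k] A) : H →ₗ[k] A) = Algebra.linearMap k A ∘ₗ counit := rfl
    rw [hl]
    nth_rw 2 [← (ℛ k h).eq]
    rw [LinearMap.rTensor_comp, LinearMap.comp_apply, rTensor_counit_comul]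
    conv_lhs => rw [← sum_counit_smul_left (ℛ k h)]
    simp [Algebra.algebraMap_eq_smul_one, smul_tmul, tmul_sum]

/-- Cohomologous by the trivial coalgebra map means equal. -/
theorem eq_of_cohomologous_counit {S T : CrossedSystem k A H} {r : H →ₗc[k] A}
    (hr : ∀ h, r h = counit (R := k) h • (1 : A)) :
    ((∀ a : A, toConv (T.act ∘ₗ (TensorProduct.mk k H A).flip a) =
      toConv (r : H →ₗ[k] A) * toConv (S.act ∘ₗ (TensorProduct.mk k H A).flip a) *
        toConv (HopfAlgebra.antipode k ∘ₗ (r : H →ₗ[k] A))) ∧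
    toConv T.cocycle =
      toConv ((r : H →ₗ[k] A) ∘ₗ (TensorProduct.rid k H).toLinearMap ∘ₗ
          (counit (R := k) (A := H)).lTensor H) *
        toConv (S.act ∘ₗ (r : H →ₗ[k] A).lTensor H) * toConv S.cocycle *
        toConv (HopfAlgebra.antipode k ∘ₗ (r : H →ₗ[k] A) ∘ₗ LinearMap.mul' k H)) ↔ T = S := by
  have h1 : toConv (r : H →ₗ[k] A) = 1 := by
    ext h
    simp [hr, Algebra.algebraMap_eq_smul_one]
  have h2 : toConv (HopfAlgebra.antipode k ∘ₗ (r : H →ₗ[k] A)) = 1 := by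
    ext h
    simp [hr, Algebra.algebraMap_eq_smul_one]
  have h3 : toConv ((r : H →ₗ[k] A) ∘ₗ (TensorProduct.rid k H).toLinearMap ∘ₗ
          (counit (R := k) (A := H)).lTensor H) = 1 := by
    apply WithConv.ext
    ext h l
    simp [hr, LinearMap.convOne_def, Algebra.algebraMap_eq_smul_one]
  have h4 : toConv (S.act ∘ₗ (r : H →ₗ[k] A).lTensor H) = 1 := by
    apply WithConv.ext
    ext h l
    simp [hr, LinearMap.convOne_def, Algebra.algebraMap_eq_smul_one, S.weak.act_one, smul_smul]
  have h5 : toConv (HopfAlgebra.antipode k ∘ₗ (r : H →ₗ[k] A) ∘ₗ LinearMap.mul' k H) = 1 := by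
    apply WithConv.ext
    ext h l
    simp [hr, LinearMap.convOne_def, Algebra.algebraMap_eq_smul_one, mul_comm]
  rw [h2, h3, h4, h5]
  simp only [h1, one_mul, mul_one]
  constructor
  · rintro ⟨ha, hf⟩
    refine CrossedSystem.ext (TensorProduct.ext' fun h a => ?_) (toConv_injective hf)
    exact LinearMap.congr_fun (toConv_injective (ha a)) h
  · rintro rfl
    exact ⟨fun _ => rfl, rfl⟩

theorem Cohomologous.refl (S : CrossedSystem k A H) : Cohomologous S S :=
  ⟨_, isUnitaryCocentral_unit_comp_counit, (eq_of_cohomologous_counit fun h =>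
    Algebra.algebraMap_eq_smul_one (R := k) (A := A) (counit h)).2 rfl⟩

end Cohomologous

section Sweedler

variable {k A : Type*} [Field k] [Ring A] [HopfAlgebra k A]

open SweedlerH4

/-- Every unitary cocentral map on `H₄` is trivial. -/
theorem IsUnitaryCocentral.apply_eq {r : SweedlerH4 k →ₗc[k] A} (hr : IsUnitaryCocentral r)
    (h : SweedlerH4 k) : r h = counit (R := k) h • (1 : A) := by
  have hx := hr.cocentral (x k)
  have hgx := hr.cocentral (g k * x k)
  simp only [comul_x, map_add, LinearMap.rTensor_tmul, TensorProduct.comm_tmul,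
    CoalgHom.coe_toLinearMap,
    hr.map_one] at hx
  obtain ⟨hx0, hg1⟩ := eq_of_tmul_one_add_tmul_x hx
  simp only [comul_gx, map_add, LinearMap.rTensor_tmul, TensorProduct.comm_tmul,
    CoalgHom.coe_toLinearMap,
    hr.map_one, hg1] at hgx
  have hgx0 := (eq_of_tmul_g_add_tmul_gx (hgx.trans (add_comm _ _))).1
  have e : (r : SweedlerH4 k →ₗ[k] A) = LinearMap.toSpanSingleton k A 1 ∘ₗ counit := by
    apply linearMap_ext <;> simp [hx0, hg1, hgx0, hr.map_one, counit_g k, counit_x k]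
  exact LinearMap.congr_fun e h

/-- Cohomologous crossed systems for `(A, H₄)` are equal, since unitary cocentral maps are
trivial. -/
theorem cohomologous_iff_eq {S T : CrossedSystem k A (SweedlerH4 k)} :
    Cohomologous S T ↔ S = T := by
  constructor
  · rintro ⟨r, hr, h⟩
    exact ((eq_of_cohomologous_counit hr.apply_eq).1 h).symm
  · rintro rfl
    exact Cohomologous.refl S

variable (k) in
/-- The algebra endomorphism of `H₄` with `g ↦ g` and `x ↦ βx`. -/
def SweedlerH4.scaleAlgHom (β : k) : SweedlerH4 k →ₐ[k] SweedlerH4 k :=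
  .ofLinearMap
    { toFun := fun h => ⟨h.re, h.imI, β * h.imJ, β * h.imK⟩
      map_add' := fun h l => by ext <;> simp [mul_add]
      map_smul' := fun c h => by ext <;> simp [mul_left_comm] }
    (by ext <;> simp) (fun h l => by ext <;> simp <;> ring)

theorem SweedlerH4.scaleAlgHom_g (β : k) : scaleAlgHom k β (g k) = g k := by
  ext <;> simp [scaleAlgHom, g]

theorem SweedlerH4.scaleAlgHom_x (β : k) : scaleAlgHom k β (x k) = β • x k := by
  ext <;> simp [scaleAlgHom, x]

variable (k) in
/-- The Hopf algebra endomorphism of `H₄` with `g ↦ g` and `x ↦ βx`. -/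
def SweedlerH4.scale (β : k) : SweedlerH4 k →ₐc[k] SweedlerH4 k :=
  .ofAlgHom (scaleAlgHom k β)
    (AlgHom.ext fun h => (counit_apply k _).trans (counit_apply k h).symm)
    (by
      apply algHom_ext
      · simp [comul_g, scaleAlgHom_g]
      · simp [comul_x, scaleAlgHom_g, scaleAlgHom_x, smul_tmul'])

theorem SweedlerH4.scale_apply (β : k) (h : SweedlerH4 k) :
    scale k β h = ⟨h.re, h.imI, β * h.imJ, β * h.imK⟩ := rfl

theorem SweedlerH4.deform_scale (β : k) (s t : SweedlerH4 k) :
    deform k (scale k β s) (scale k β t) = β ^ 2 • scale k β (deform k s t) := by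
  ext <;> simp [deform_apply, scale_apply] <;> ring

theorem SweedlerH4.scale_scale (β γ : k) (s : SweedlerH4 k) :
    scale k β (scale k γ s) = scale k (β * γ) s := by
  ext <;> simp [scale_apply, mul_assoc]

theorem SweedlerH4.scale_one (s : SweedlerH4 k) : scale k 1 s = s := by
  ext <;> simp [scale_apply]

/-- An automorphism `u` of `A` and a scalar `β` with `u(a) = β² b` give an isomorphism
`c # h ↦ u(c) # v(h)` of crossed products, where `v(g) = g` and `v(x) = βx`. -/
theorem nonempty_bialgEquiv_sweedlerSystem {a b : CentralPrimitive k A} (u : A ≃ₐc[k] A) (β : kˣ)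
    (h : u a.1 = ((β : k) ^ 2) • b.1) :
    Nonempty ((sweedlerSystem k a).Product ≃ₐc[k] (sweedlerSystem k b).Product) := by
  set F : A ⊗[k] SweedlerH4 k →ₗc[k] A ⊗[k] SweedlerH4 k :=
    Coalgebra.TensorProduct.map ((u : A →ₐc[k] A) : A →ₗc[k] A)
      ((scale k (β : k) : SweedlerH4 k →ₐc[k] SweedlerH4 k) : SweedlerH4 k →ₗc[k] SweedlerH4 k)
    with hF
  have F_tmul (c : A) (s : SweedlerH4 k) : F (c ⊗ₜ s) = u c ⊗ₜ scale k (β : k) s := rfl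
  have F_mul (y z : A ⊗[k] SweedlerH4 k) :
      F (crossedMul (sweedlerSystem k a).act (sweedlerSystem k a).cocycle y z) =
        crossedMul (sweedlerSystem k b).act (sweedlerSystem k b).cocycle (F y) (F z) := by
    induction y with
    | zero => simp only [map_zero, LinearMap.zero_apply]
    | add y y' hy hy' => simp only [map_add, LinearMap.add_apply, hy, hy']
    | tmul c s =>
    induction z with
    | zero => simp only [map_zero]
    | add z z' hz hz' => simp only [map_add, hz, hz']
    | tmul d t =>
    refine (congrArg F (crossedMul_sweedlerCocycle a.1 c d s t)).trans ?_
    rw [F_tmul, F_tmul]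
    refine Eq.trans ?_ (crossedMul_sweedlerCocycle b.1 _ _ _ _).symm
    rw [map_add, F_tmul, F_tmul, map_mul, map_mul, map_mul, map_mul, h, deform_scale, mul_smul_comm,
      smul_tmul]
  have hbij : Function.Bijective F := by
    refine Function.bijective_iff_has_inverse.2
      ⟨TensorProduct.map (u.symm : A →ₗ[k] A)
        (scale k (↑β⁻¹ : k) : SweedlerH4 k →ₗ[k] SweedlerH4 k),
        fun z => ?_, fun z => ?_⟩
    · induction z with
      | zero => simp only [map_zero]
      | add y z hy hz => simp only [map_add, hy, hz]
      | tmul c s => simp [F_tmul, scale_scale, scale_one]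
    · induction z with
      | zero => simp only [map_zero]
      | add y z hy hz => simp only [map_add, hy, hz]
      | tmul c s => simp [F_tmul, scale_scale, scale_one]
  let G : (sweedlerSystem k a).Product →ₐc[k] (sweedlerSystem k b).Product :=
    .ofAlgHom
      (.ofLinearMap (F : A ⊗[k] SweedlerH4 k →ₗ[k] A ⊗[k] SweedlerH4 k)
        ((F_tmul 1 1).trans (by rw [map_one, map_one]; rfl)) F_mul)
      (by ext z; exact LinearMap.congr_fun F.counit_comp z)
      (by ext z; exact LinearMap.congr_fun F.map_comp_comul z)
  exact ⟨BialgEquiv.ofBijective G hbij⟩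

/-- The grouplike elements of `H₄` are `1` and `g`. -/
theorem SweedlerH4.eq_one_or_eq_g_of_comul {q : SweedlerH4 k} (h : comul (R := k) q = q ⊗ₜ q)
    (h1 : counit (R := k) q = 1) : q = 1 ∨ q = g k := by
  have hc : comul (R := k) q = q.re • (1 ⊗ₜ 1) + q.imI • (g k ⊗ₜ g k) +
      q.imJ • (x k ⊗ₜ 1 + g k ⊗ₜ x k) +
      q.imK • ((g k * x k) ⊗ₜ g k + 1 ⊗ₜ (g k * x k)) := by
    nth_rw 1 [eq_basis k q]
    simp only [map_add, map_smul, comul_one, comul_g, comul_x, comul_gx]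
  rw [hc] at h
  have e (φ ψ : SweedlerH4 k →ₗ[k] k) := congrArg (LinearMap.mul' k k ∘ₗ TensorProduct.map φ ψ) h
  -- The coefficients at `1 ⊗ g`, `x ⊗ x` and `gx ⊗ gx`.
  have e1 := e (QuaternionAlgebra.reₗ 1 0 0) (QuaternionAlgebra.imIₗ 1 0 0)
  have e2 := e (QuaternionAlgebra.imJₗ 1 0 0) (QuaternionAlgebra.imJₗ 1 0 0)
  have e3 := e (QuaternionAlgebra.imKₗ 1 0 0) (QuaternionAlgebra.imKₗ 1 0 0)
  simp [g, x] at e1 e2 e3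
  rw [counit_apply] at h1
  rcases e1 with e1 | e1
  · right
    ext <;> simp_all [g]
  · left
    ext <;> simp_all

/-- A `(g, 1)`-primitive element of `H₄` which anticommutes with `g` is a multiple of `x`. -/
theorem SweedlerH4.eq_smul_x (hk : (2 : k) ≠ 0) {p : SweedlerH4 k}
    (h : comul (R := k) p = p ⊗ₜ 1 + g k ⊗ₜ p) (h' : p * g k = -(g k * p)) :
    p = p.imJ • x k := by
  have hc : comul (R := k) p = p.re • (1 ⊗ₜ 1) + p.imI • (g k ⊗ₜ g k) +
      p.imJ • (x k ⊗ₜ 1 + g k ⊗ₜ x k) +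
      p.imK • ((g k * x k) ⊗ₜ g k + 1 ⊗ₜ (g k * x k)) := by
    nth_rw 1 [eq_basis k p]
    simp only [map_add, map_smul, comul_one, comul_g, comul_x, comul_gx]
  rw [hc] at h
  -- The coefficient at `1 ⊗ gx`.
  have e := congrArg (LinearMap.mul' k k ∘ₗ TensorProduct.map (QuaternionAlgebra.reₗ 1 0 0)
    (QuaternionAlgebra.imKₗ 1 0 0)) h
  simp [g, x] at e
  have h0 := congrArg QuaternionAlgebra.re h'
  have h1 := congrArg QuaternionAlgebra.imI h'
  simp [g] at h0 h1
  have h2 : p.imI = 0 := by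
    have : (2 : k) * p.imI = 0 := by linear_combination h0
    simpa [hk] using this
  have h3 : p.re = 0 := by
    have : (2 : k) * p.re = 0 := by linear_combination h1
    simpa [hk] using this
  ext <;> simp [x, e, h2, h3]

end Sweedler

/-! ### The invariant of a crossed product up to isomorphism -/

namespace CrossedSystem

variable {k A : Type*} [Field k] [Ring A] [HopfAlgebra k A]

open SweedlerH4

section Restriction

variable {S T : CrossedSystem k A (SweedlerH4 k)}

/-- If all Hopf algebra maps `A → H₄` are trivial, then maps of crossed products send `A` to `A`:
the image of `A` consists of coinvariants of the projection to `H₄`. -/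
theorem map_incl
    (hA : ∀ (p : A →ₐc[k] SweedlerH4 k) (a : A), p a = algebraMap k (SweedlerH4 k) (counit a))
    (e : S.Product →ₐc[k] T.Product) (c : A) :
    e (S.incl c) = T.incl (T.projLeft (e (S.incl c))) := by
  have h (d : A) : T.projRight (e (S.incl d)) = counit (R := k) d • 1 :=
    (hA ((T.projRight.comp e).comp S.incl) d).trans (Algebra.algebraMap_eq_smul_one _)
  apply T.ext_toTensor
  rw [toTensor_incl, ← map_projLeft_projRight_comul, ← CoalgHomClass.map_comp_comul_apply,
    comul_incl]
  conv_rhs => rw [← sum_counit_smul_left (ℛ k c)]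
  simp [h, sum_tmul, tmul_smul, smul_tmul']

/-- The restriction to `A` of a map of crossed products. -/
def restrict
    (hA : ∀ (p : A →ₐc[k] SweedlerH4 k) (a : A), p a = algebraMap k (SweedlerH4 k) (counit a))
    (e : S.Product →ₐc[k] T.Product) : A →ₐc[k] A :=
  .ofAlgHom
    (.ofLinearMap (T.projLeft ∘ₗ (e : S.Product →ₗ[k] T.Product) ∘ₗ (S.incl : A →ₗ[k] S.Product))
      (by simp [projLeft_one])
      (fun c d => by
        apply T.incl_injective
        change T.incl (T.projLeft (e (S.incl (c * d)))) =
          T.incl (T.projLeft (e (S.incl c)) * T.projLeft (e (S.incl d)))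
        rw [← map_incl hA, map_mul T.incl, ← map_incl hA, ← map_incl hA, map_mul, map_mul]))
    (by
      ext c
      exact (counit_tensorFst _).trans
        ((CoalgHomClass.counit_comp_apply e (S.incl c)).trans
          (CoalgHomClass.counit_comp_apply S.incl c)))
    (by
      ext c
      refine Eq.trans ?_ (T.map_projLeft_projLeft_comul (e (S.incl c)))
      rw [← CoalgHomClass.map_comp_comul_apply, ← CoalgHomClass.map_comp_comul_apply,
        ← LinearMap.comp_apply, ← LinearMap.comp_apply, ← TensorProduct.map_comp,
        ← TensorProduct.map_comp]
      rfl)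

theorem incl_restrict
    (hA : ∀ (p : A →ₐc[k] SweedlerH4 k) (a : A), p a = algebraMap k (SweedlerH4 k) (counit a))
    (e : S.Product →ₐc[k] T.Product) (c : A) : T.incl (restrict hA e c) = e (S.incl c) :=
  (map_incl hA e c).symm

/-- The restriction to `A` of an isomorphism of crossed products. -/
def restrictEquiv
    (hA : ∀ (p : A →ₐc[k] SweedlerH4 k) (a : A), p a = algebraMap k (SweedlerH4 k) (counit a))
    (e : S.Product ≃ₐc[k] T.Product) : A ≃ₐc[k] A :=
  .ofBialgHom (restrict hA (e : S.Product →ₐc[k] T.Product))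
    (restrict hA (e.symm : T.Product →ₐc[k] S.Product))
    (by
      ext c
      apply T.incl_injective
      simp [incl_restrict])
    (by
      ext c
      apply S.incl_injective
      simp [incl_restrict])

theorem incl_restrictEquiv
    (hA : ∀ (p : A →ₐc[k] SweedlerH4 k) (a : A), p a = algebraMap k (SweedlerH4 k) (counit a))
    (e : S.Product ≃ₐc[k] T.Product) (c : A) : T.incl (restrictEquiv hA e c) = e (S.incl c) :=
  incl_restrict hA (e : S.Product →ₐc[k] T.Product) c

/-- A linear map on a crossed product vanishes once it vanishes on `c(1 # s)` for `s` in the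
basis of `H₄`. -/
theorem linearMap_eq_zero {B : Type*} [AddCommGroup B] [Module k B] (F : S.Product →ₗ[k] B)
    (h1 : ∀ c, F (S.incl c) = 0) (hg : ∀ c, F (S.incl c * S.sec (g k)) = 0)
    (hx : ∀ c, F (S.incl c * S.sec (x k)) = 0)
    (hgx : ∀ c, F (S.incl c * (S.sec (g k) * S.sec (x k))) = 0) : F = 0 := by
  have e : F ∘ₗ S.toTensor.symm.toLinearMap = 0 := by
    refine TensorProduct.ext' fun c s => ?_
    have e' : F ∘ₗ LinearMap.mulLeft k (S.incl c) ∘ₗ S.sec = 0 := by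
      apply linearMap_ext <;>
        simp only [LinearMap.comp_apply, LinearMap.mulLeft_apply, LinearMap.zero_apply, sec_one,
          _root_.mul_one, ← sec_g_mul_sec_x, h1, hg, hx, hgx]
    have : S.toTensor.symm (c ⊗ₜ s) = S.incl c * S.sec s := by
      rw [LinearEquiv.symm_apply_eq, toTensor_incl_mul_sec]
    rw [LinearMap.comp_apply, LinearEquiv.coe_coe, this]
    exact LinearMap.congr_fun e' s
  refine LinearMap.ext fun z => ?_
  exact LinearMap.congr_fun e (S.toTensor z)

/-- An isomorphism of crossed products sends `1 # x` to a nonzero multiple of `1 # x`. -/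
theorem exists_map_sec_x (hk : (2 : k) ≠ 0)
    (hA : ∀ (p : A →ₐc[k] SweedlerH4 k) (a : A), p a = algebraMap k (SweedlerH4 k) (counit a))
    (e : S.Product ≃ₐc[k] T.Product) :
    ∃ β : kˣ, e (S.sec (x k)) = (β : k) • T.sec (x k) := by
  set φ : S.Product →ₐc[k] SweedlerH4 k := T.projRight.comp (e : S.Product →ₐc[k] T.Product) with hφ
  have hφe (z : S.Product) : T.projRight (e z) = φ z := rfl
  have φ_incl (c : A) : φ (S.incl c) = counit (R := k) c • 1 :=
    (hA (φ.comp S.incl) c).trans (Algebra.algebraMap_eq_smul_one _)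
  have φ_surj (s : SweedlerH4 k) : φ (e.symm (T.sec s)) = s := by
    rw [← hφe, BialgEquiv.apply_symm_apply, projRight_sec]
  set q := φ (S.sec (g k)) with hq
  set p := φ (S.sec (x k)) with hp
  have q_comul : comul (R := k) q = q ⊗ₜ q := by
    rw [hq, ← CoalgHomClass.map_comp_comul_apply, comul_sec_g]
    simp
  have q_counit : counit (R := k) q = 1 := by
    rw [hq, CoalgHomClass.counit_comp_apply, ← S.counit_toTensor, toTensor_sec]
    simp [counit_g]
  have p_comul : comul (R := k) p = p ⊗ₜ 1 + q ⊗ₜ p := by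
    rw [hp, ← CoalgHomClass.map_comp_comul_apply, comul_sec_x]
    simp [hq]
  have p_mul_q : p * q = -(q * p) := by
    rw [hp, hq, ← map_mul φ, ← map_mul φ, ← map_neg, sec_x_mul_sec_g, sec_g_mul_sec_x]
  -- The image of `φ` would be spanned by `1` if `q = 1`.
  have hqg : q = g k := by
    refine (eq_one_or_eq_g_of_comul q_comul q_counit).resolve_left fun hq1 => ?_
    have hp0 : p = 0 := by
      rw [hq1, _root_.mul_one, _root_.one_mul] at p_mul_q
      have : (2 : k) • p = 0 := by rw [two_smul]; nth_rw 1 [p_mul_q]; exact neg_add_cancel p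
      simpa [hk] using this
    have h0 : QuaternionAlgebra.imIₗ 1 0 0 ∘ₗ (φ : S.Product →ₗ[k] SweedlerH4 k) = 0 := by
      apply linearMap_eq_zero <;> intro c <;>
        simp [φ_incl, ← hq, ← hp, hq1, hp0]
    have h1 := LinearMap.congr_fun h0 (e.symm (T.sec (g k)))
    simp [φ_surj, g] at h1
  rw [hqg] at p_comul p_mul_q
  obtain ⟨β, hpx⟩ : ∃ β : k, p = β • x k := ⟨_, eq_smul_x hk p_comul p_mul_q⟩
  -- The image of `φ` would be spanned by `1` and `g` if `p = 0`.
  have hβ : β ≠ 0 := by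
    intro hβ
    rw [hβ, zero_smul] at hpx
    have hgJ : (g k).imJ = 0 := rfl
    have h0 : QuaternionAlgebra.imJₗ 1 0 0 ∘ₗ (φ : S.Product →ₗ[k] SweedlerH4 k) = 0 := by
      apply linearMap_eq_zero <;> intro c <;>
        simp [φ_incl, show φ (S.sec (g k)) = g k from hqg, ← hp, hpx, hgJ]
    have h1 := LinearMap.congr_fun h0 (e.symm (T.sec (x k)))
    simp [φ_surj, x] at h1
  refine ⟨Units.mk0 _ hβ, ?_⟩
  -- Both expressions of `e (1 # x)` through the components of its comultiplication.
  have hc : comul (R := k) (e (S.sec (x k))) =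
      e (S.sec (x k)) ⊗ₜ 1 + e (S.sec (g k)) ⊗ₜ e (S.sec (x k)) := by
    rw [← CoalgHomClass.map_comp_comul_apply, comul_sec_x]
    simp
  have h1 := T.map_projLeft_projRight_comul (e (S.sec (x k)))
  have h2 := T.map_projRight_projLeft_comul (e (S.sec (x k)))
  rw [hc, map_add, TensorProduct.map_tmul, TensorProduct.map_tmul] at h1 h2
  simp only [BialgHom.coe_toLinearMap, hφe, map_one, projLeft_one, ← hq, ← hp, hqg] at h1 h2
  rw [hpx, tmul_smul] at h1
  rw [← h1, hpx] at h2
  have h3 := congrArg (TensorProduct.comm k (SweedlerH4 k) A) h2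
  simp only [map_add, TensorProduct.comm_tmul, map_smul] at h3
  rw [smul_tmul', tmul_smul, smul_tmul'] at h3
  have h4 := eq_of_tmul_one_add_tmul_x h3.symm
  apply T.ext_toTensor
  rw [← h1, h4.1, zero_tmul, zero_add, smul_tmul', h4.2, map_smul, toTensor_sec, smul_tmul',
    Units.val_mk0]

/-- Squaring `e (1 # x) = β (1 # x)` relates the central primitive elements of the two systems. -/
theorem exists_map_param (hk : (2 : k) ≠ 0)
    (hA : ∀ (p : A →ₐc[k] SweedlerH4 k) (a : A), p a = algebraMap k (SweedlerH4 k) (counit a))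
    (e : S.Product ≃ₐc[k] T.Product) :
    ∃ (u : A ≃ₐc[k] A) (β : kˣ), u S.param = ((β : k) ^ 2) • T.param := by
  obtain ⟨β, hβ⟩ := exists_map_sec_x hk hA e
  refine ⟨restrictEquiv hA e, β, T.incl_injective ?_⟩
  rw [incl_restrictEquiv, map_smul, ← sec_x_mul_sec_x, ← sec_x_mul_sec_x, map_mul, hβ,
    smul_mul_smul_comm, sq]

end Restriction

/-- Crossed products of central primitive elements are isomorphic exactly when the elements are
equivalent. -/
theorem mk_sweedlerSystem_eq_iff (hk : (2 : k) ≠ 0)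
    (hA : ∀ (p : A →ₐc[k] SweedlerH4 k) (a : A), p a = algebraMap k (SweedlerH4 k) (counit a))
    (a b : CentralPrimitive k A) :
    Crp.mk (sweedlerSystem k a) = Crp.mk (sweedlerSystem k b) ↔
      CentralPrimitive.setoid k A a b := by
  refine Quotient.eq.trans ⟨fun ⟨e⟩ => ?_, fun ⟨u, β, h⟩ =>
    nonempty_bialgEquiv_sweedlerSystem u β h⟩
  obtain ⟨u, β, h⟩ := exists_map_param hk hA e
  rw [param_sweedlerSystem, param_sweedlerSystem] at h
  exact ⟨u, β, h⟩

end CrossedSystem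

end

theorem mainTheorem1 {k : Type*} [Field k] (hk : ringChar k ≠ 2)
    {A : Type*} [Ring A] [HopfAlgebra k A]
    (hA : ∀ (p : A →ₐc[k] SweedlerH4 k) (a : A),
      p a = algebraMap k (SweedlerH4 k) (Coalgebra.counit a)) :
    (∃ Φ : Quotient (CentralPrimitive.setoid k A) ≃ Crp k (SweedlerH4 k) A,
      ∀ a : CentralPrimitive k A, ∃ S : CrossedSystem k A (SweedlerH4 k),
        S.act = trivialAction k (SweedlerH4 k) A ∧ S.cocycle = sweedlerCocycle a.1 ∧
          Φ (Quotient.mk _ a) = Crp.mk S) ∧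
    Equivalence (Cohomologous (k := k) (A := A) (H := SweedlerH4 k)) ∧
    (∃ Ψ : CentralPrimitive k A ≃ HopfH2 k (SweedlerH4 k) A,
      ∀ a : CentralPrimitive k A, ∃ S : CrossedSystem k A (SweedlerH4 k),
        S.act = trivialAction k (SweedlerH4 k) A ∧ S.cocycle = sweedlerCocycle a.1 ∧
          Ψ a = HopfH2.mk S) := by
  have hk2 : (2 : k) ≠ 0 := Ring.two_ne_zero hk
  have hsurj (S : CrossedSystem k A (SweedlerH4 k)) : ∃ a, sweedlerSystem k a = S :=
    ⟨_, S.sweedlerSystem_centralPrimitive⟩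
  refine ⟨?_, ?_, ?_⟩
  · refine ⟨Equiv.ofBijective (Quotient.lift (fun a => Crp.mk (sweedlerSystem k a)) fun a b h =>
      (CrossedSystem.mk_sweedlerSystem_eq_iff hk2 hA a b).2 h) ⟨?_, ?_⟩,
      fun a => ⟨sweedlerSystem k a, rfl, rfl, rfl⟩⟩
    · rintro ⟨a⟩ ⟨b⟩ h
      exact Quotient.sound ((CrossedSystem.mk_sweedlerSystem_eq_iff hk2 hA a b).1 h)
    · rintro ⟨S⟩
      obtain ⟨a, rfl⟩ := hsurj S
      exact ⟨Quotient.mk _ a, rfl⟩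
  · have h : Cohomologous (k := k) (A := A) (H := SweedlerH4 k) = Eq := by
      ext S T
      exact cohomologous_iff_eq
    rw [h]
    exact eq_equivalence
  · refine ⟨Equiv.ofBijective (fun a => HopfH2.mk (sweedlerSystem k a)) ⟨?_, ?_⟩,
      fun a => ⟨sweedlerSystem k a, rfl, rfl, rfl⟩⟩
    · intro a b h
      have h' : sweedlerSystem k a = sweedlerSystem k b := by
        refine congrArg (Quot.lift id fun S T h => ?_) h
        exact cohomologous_iff_eq.1 h
      exact CrossedSystem.equivCentralPrimitive.injective h'
    · rintro ⟨S⟩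
      obtain ⟨a, rfl⟩ := hsurj S
      exact ⟨a, rfl⟩
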